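/- Let $d\ge 1$, let $s\ge 0$, and let $p\in[1,\infty]$ satisfy $p>\frac{2d}{d+s}$. For nonzero $\phi\in\mathcal S(\mathbb R^{2d})$ and $f\in\mathcal S'(\mathbb R^{2d})$ put $V_\phi f(x,\xi)=\langle f, M_\xi T_x\phi\rangle$, $x,\xi\in\mathbb R^{2d}$, where $M_\xi T_x\phi(t)=e^{2\pi i t\cdot\xi}\phi(t-x)$ and $\langle\cdot,\cdot\rangle$ is linear in the first and conjugate-linear in the second argument; regard $V_\phi f$ as a function on $\mathbb R^{4d}$. For $p_1,\dots,p_{4d}\in[1,\infty]$ and a weight $w$ on $\mathbb R^{4d}$ let $\|F\|_{L_w^{p_1,\dots,p_{4d}}}$ be the mixed norm obtained by taking, of $|Fw|$, the $L^{p_1}(\mathbb R)$-norm in the first variable, then the $L^{p_2}(\mathbb R)$-norm in the second variable, and so on up to the $L^{p_{4d}}(\mathbb R)$-norm in the last variable. Let $$M^{2,2}_{v_s}(\mathbb R^{2d})=\{f\in\mathcal S'(\mathbb R^{2d}): \|V_\phi f\|_{L_{v_s}^{2,\dots,2}}<\infty\},\qquad v_s(z)=(1+|z|)^s,$$ and,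 for a permutation $c$ of $\{1,\dots,4d\}$ with associated map $\mathfrak c(x_1,\dots,x_{4d})=(x_{c(1)},\dots,x_{c(4d)})$, let $$M(c)^{p_1,\dots,p_{4d}}=\{f\in\mathcal S'(\mathbb R^{2d}): \|V_\psi f\circ\mathfrak c\|_{L^{p_1,\dots,p_{4d}}}<\infty\},$$ where $\phi,\psi\in\mathcal S(\mathbb R^{2d})$ are arbitrary nonzero windows (not necessarily equal). Suppose that $c$ is a slice permutation, i.e. $c$ maps $\{1,\dots,d\}\cup\{2d+1,\dots,3d\}$ bijectively onto $\{1,\dots,2d\}$ and $\{d+1,\dots,2d\}\cup\{3d+1,\dots,4d\}$ bijectively onto $\{2d+1,\dots,4d\}$, and let $p_1=\dots=p_{2d}=2$ and $p_{2d+1}=\dots=p_{4d}=p$. Then $$M^{2,2}_{v_s}(\mathbb R^{2d})\subsetneq M(c)^{p_1,\dots,p_{4d}}.$$ -/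

import Mathlib

open MeasureTheory
open scoped SchwartzMap ENNReal

noncomputable section

namespace MixedMod

/-- The function `x ↦ e^{ix}` on the real line is of temperate growth. -/
theorem hasTemperateGrowth_cexp_I :
    Function.HasTemperateGrowth (fun x : ℝ => Complex.exp (Complex.I * (x : ℂ))) := by
  have hd : ∀ n : ℕ, iteratedDeriv n (fun x : ℝ => Complex.exp (Complex.I * (x : ℂ))) =
      fun x : ℝ => Complex.I ^ n * Complex.exp (Complex.I * (x : ℂ)) := by
    intro n
    induction n with
    | zero => simp
    | succ n ih =>
      rw [iteratedDeriv_succ, ih]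
      funext x
      have h1 : HasDerivAt (fun x : ℝ => Complex.I * (x : ℂ)) (Complex.I * 1) x :=
        (Complex.ofRealCLM.hasDerivAt (x := x)).const_mul Complex.I
      have h2 := (h1.cexp).const_mul (Complex.I ^ n)
      rw [h2.deriv]
      ring
  refine ⟨?_, fun n => ⟨0, 1, fun x => ?_⟩⟩
  · exact Complex.contDiff_exp.comp (contDiff_const.mul Complex.ofRealCLM.contDiff)
  · rw [norm_iteratedFDeriv_eq_norm_iteratedDeriv, hd n]
    simp [mul_comm Complex.I, Complex.norm_exp_ofReal_mul_I]

/-- The character `t ↦ e^{2πi t·ξ}` of `ℝⁿ`. -/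
def character {n : ℕ} (ξ t : EuclideanSpace ℝ (Fin n)) : ℂ :=
  Complex.exp (Complex.I * ((2 * Real.pi * inner ℝ t ξ : ℝ) : ℂ))

theorem hasTemperateGrowth_character {n : ℕ} (ξ : EuclideanSpace ℝ (Fin n)) :
    Function.HasTemperateGrowth (character ξ) := by
  have h : Function.HasTemperateGrowth
      (fun t : EuclideanSpace ℝ (Fin n) => 2 * Real.pi * inner ℝ t ξ) := by fun_prop
  exact hasTemperateGrowth_cexp_I.comp h

/-- The time-frequency shift `M_ξ T_x φ` of a Schwartz function:
`(M_ξ T_x φ)(t) = e^{2πi t·ξ} φ(t - x)`. -/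
def timeFreqShift {n : ℕ} (x ξ : EuclideanSpace ℝ (Fin n))
    (φ : 𝓢(EuclideanSpace ℝ (Fin n), ℂ)) : 𝓢(EuclideanSpace ℝ (Fin n), ℂ) :=
  SchwartzMap.smulLeftCLM ℂ (character ξ) (SchwartzMap.compSubConstCLM ℂ x φ)

theorem timeFreqShift_apply {n : ℕ} (x ξ t : EuclideanSpace ℝ (Fin n))
    (φ : 𝓢(EuclideanSpace ℝ (Fin n), ℂ)) :
    timeFreqShift x ξ φ t =
      Complex.exp (Complex.I * ((2 * Real.pi * inner ℝ t ξ : ℝ) : ℂ)) * φ (t - x) := by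
  simp [timeFreqShift, SchwartzMap.smulLeftCLM_apply_apply (hasTemperateGrowth_character ξ),
    character]

/-- Complex conjugation of Schwartz functions. -/
def conjSchwartz {n : ℕ} (φ : 𝓢(EuclideanSpace ℝ (Fin n), ℂ)) :
    𝓢(EuclideanSpace ℝ (Fin n), ℂ) :=
  SchwartzMap.postcompCLM (𝕜 := ℝ) (Complex.conjCLE : ℂ →L[ℝ] ℂ) φ

theorem conjSchwartz_apply {n : ℕ} (φ : 𝓢(EuclideanSpace ℝ (Fin n), ℂ))
    (t : EuclideanSpace ℝ (Fin n)) : conjSchwartz φ t = starRingEnd ℂ (φ t) := rfl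

/-- The Gabor transform `V_φ f (x, ξ) = ⟨f, M_ξ T_x φ⟩` of a tempered distribution `f`.
The bracket extends the inner product of `L²(ℝⁿ)` that is linear in the first argument and
conjugate-linear in the second, so the (linear) functional `f` is evaluated at the complex
conjugate of `M_ξ T_x φ`. -/
def gaborTransform {n : ℕ} (φ : 𝓢(EuclideanSpace ℝ (Fin n), ℂ))
    (f : 𝓢'(EuclideanSpace ℝ (Fin n), ℂ)) (x ξ : EuclideanSpace ℝ (Fin n)) : ℂ :=
  f (conjSchwartz (timeFreqShift x ξ φ))

/-- The Gabor transform as a function of one variable `z = (x, ξ) ∈ ℝ²ⁿ`: the first `n`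
coordinates of `z` are `x`, the last `n` are `ξ`. -/
def gaborTransformPhase {n : ℕ} (φ : 𝓢(EuclideanSpace ℝ (Fin n), ℂ))
    (f : 𝓢'(EuclideanSpace ℝ (Fin n), ℂ)) (z : Fin (n + n) → ℝ) : ℂ :=
  gaborTransform φ f (WithLp.toLp 2 fun i => z (Fin.castAdd n i))
    (WithLp.toLp 2 fun i => z (Fin.natAdd n i))

/-- The iterated norm of a `[0, ∞]`-valued function on `ℝⁿ`: take the `L^{p₁}(ℝ)` norm in the
first variable, then the `L^{p₂}(ℝ)` norm of the result in the second variable, and so on; the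
last variable is treated last (outermost). `eLpNorm` uses the essential supremum at `∞`. -/
def iteratedLpNorm : (n : ℕ) → (Fin n → ℝ≥0∞) → ((Fin n → ℝ) → ℝ≥0∞) → ℝ≥0∞
  | 0, _, F => F Fin.elim0
  | n + 1, p, F =>
      eLpNorm (fun t : ℝ => iteratedLpNorm n (Fin.init p) fun y => F (Fin.snoc y t))
        (p (Fin.last n)) volume

/-- The norm of the weighted mixed norm space `L_w^{p₁, …, pₙ}` on `ℝⁿ`. -/
def mixedLpNorm {n : ℕ} (p : Fin n → ℝ≥0∞) (w : (Fin n → ℝ) → ℝ) (F : (Fin n → ℝ) → ℂ) : ℝ≥0∞ :=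
  iteratedLpNorm n p fun x => ‖F x * (w x : ℂ)‖ₑ

/-- The weight `v_s(z) = (1 + |z|)^s`, with `|z|` the Euclidean norm. -/
def polyWeight {n : ℕ} (s : ℝ) (z : Fin n → ℝ) : ℝ :=
  (1 + ‖(WithLp.toLp 2 z : EuclideanSpace ℝ (Fin n))‖) ^ s

/-- The modulation space `M_w^{p,q}(ℝⁿ)`, defined with the window `φ`. -/
def modulationSpace {n : ℕ} (φ : 𝓢(EuclideanSpace ℝ (Fin n), ℂ)) (p q : ℝ≥0∞)
    (w : (Fin (n + n) → ℝ) → ℝ) : Set 𝓢'(EuclideanSpace ℝ (Fin n), ℂ) :=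
  {f | mixedLpNorm (Fin.append (fun _ : Fin n => p) (fun _ : Fin n => q)) w
    (gaborTransformPhase φ f) < ∞}

/-- The mixed modulation space `M(c)_w^{p₁, …, p₂ₙ}` of tempered distributions on `ℝⁿ`, defined
with the window `φ`: the permutation `c` acts by `(x₁, …, x₂ₙ) ↦ (x_{c(1)}, …, x_{c(2n)})`. -/
def mixedModulationSpace {n : ℕ} (φ : 𝓢(EuclideanSpace ℝ (Fin n), ℂ))
    (c : Equiv.Perm (Fin (n + n))) (p : Fin (n + n) → ℝ≥0∞)
    (w : (Fin (n + n) → ℝ) → ℝ) : Set 𝓢'(EuclideanSpace ℝ (Fin n), ℂ) :=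
  {f | mixedLpNorm p w (fun x => gaborTransformPhase φ f fun i => x (c i)) < ∞}

/-- Slice permutations of the `4d` indices (numbered from `0`): `c` maps
`{0, …, d-1} ∪ {2d, …, 3d-1}` bijectively onto `{0, …, 2d-1}`, and
`{d, …, 2d-1} ∪ {3d, …, 4d-1}` bijectively onto `{2d, …, 4d-1}`. -/
def IsSlicePermutation {d : ℕ} (c : Equiv.Perm (Fin ((d + d) + (d + d)))) : Prop :=
  Set.BijOn c {i | i.val < d ∨ (2 * d ≤ i.val ∧ i.val < 3 * d)} {j | j.val < 2 * d} ∧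
  Set.BijOn c {i | (d ≤ i.val ∧ i.val < 2 * d) ∨ 3 * d ≤ i.val} {j | 2 * d ≤ j.val}

end MixedMod

end

/-! Put n = 2d; the condition on p then reads n < (p/2)(2s + n) when p is finite.

Inclusion. The inversion formula for the Gabor transform, tested against a shifted window, bounds
|V_ψ f| pointwise by the convolution of |V_φ f| with (1 + |z|)^{-r}, where r is as large as desired
(`exists_enorm_gaborTransformPhase_le`). Peetre's inequality moves s powers of the decay onto the
weight. After the coordinates are permuted, the slice integrals y ↦ ∫ |V_ψ f(x, y)|² dx are
therefore at most (1 + |y|)^{-2s} g(y) with g both bounded and integrable (`exists_slice_bound`).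
For p ≥ 2, p = ∞ included, boundedness of g suffices to pass to the power p/2. For p < 2, Young's
inequality leaves a power of 1 + |y| whose integrability is exactly the condition on p
(`lintegral_rpow_lt_top`). Pulling a tempered distribution through the inversion integral is
`temperedDistribution_integral`.

Strictness. The examples are combs f = Σ a_i |φ(· - y_i)|², made from the window φ of the smaller
space. Plancherel in ξ gives ∫ |V_φ f(x, ξ)|² dξ = ∫ |φ(t - x)|² f(t)² dt. By positivity the cross
terms of f² may be dropped, so f lies outside the smaller space as soon as Σ a_i² (1 + |y_i|)^{2s} =
∞ (`ofBounded_comb_notMem_modulationSpace`). In the larger space no weight is present, and |V_ψ f|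
is dominated by a sum of decaying kernels centred at the (y_i, 0). If s > 0, summable coefficients
with very remote y_i, placed along a direction that c sends to the L² block, give a separating f. If
s = 0, then p > 2; lattice points along a direction that c sends to the L^p block make the mixed
norm controlled by the ℓ^p norm of a, and a is taken in ℓ^p but not in ℓ². The slice property
provides both directions. -/

noncomputable section

namespace MixedMod

open Filter Topology FourierTransform ComplexConjugate

/-! ### Schwartz seminorms and translations -/

section OrderSeminorm

variable {E E' : Type*} [NormedAddCommGroup E] [NormedSpace ℝ E]
  [NormedAddCommGroup E'] [NormedSpace ℝ E']

/-- The largest of the Schwartz seminorms of order at most `(m, m)`. -/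
def orderSeminorm (E : Type*) [NormedAddCommGroup E] [NormedSpace ℝ E] (m : ℕ) :
    Seminorm ℝ 𝓢(E, ℂ) :=
  (Finset.Iic (m, m)).sup (schwartzSeminormFamily ℝ E ℂ)

theorem seminorm_le_orderSeminorm {m k l : ℕ} (hk : k ≤ m) (hl : l ≤ m) (f : 𝓢(E, ℂ)) :
    SchwartzMap.seminorm ℝ k l f ≤ orderSeminorm E m f :=
  Seminorm.le_def.1 (Finset.le_sup (f := schwartzSeminormFamily ℝ E ℂ)
    (b := (k, l)) (Finset.mem_Iic.2 (Prod.mk_le_mk.2 ⟨hk, hl⟩))) f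

theorem orderSeminorm_le {m : ℕ} {f : 𝓢(E, ℂ)} {a : ℝ} (ha : 0 ≤ a)
    (h : ∀ k ≤ m, ∀ l ≤ m, SchwartzMap.seminorm ℝ k l f ≤ a) : orderSeminorm E m f ≤ a := by
  refine Seminorm.finset_sup_apply_le ha fun i hi => ?_
  have := Finset.mem_Iic.1 hi
  exact h i.1 this.1 i.2 this.2

theorem one_add_pow_mul_le_orderSeminorm {m k l : ℕ} (hk : k ≤ m) (hl : l ≤ m) (f : 𝓢(E, ℂ))
    (x : E) : (1 + ‖x‖) ^ k * ‖iteratedFDeriv ℝ l f x‖ ≤ 2 ^ m * orderSeminorm E m f :=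
  SchwartzMap.one_add_le_sup_seminorm_apply (𝕜 := ℝ) (m := (m, m)) hk hl f x

theorem one_add_pow_mul_norm_le_orderSeminorm (m : ℕ) (f : 𝓢(E, ℂ)) (x : E) :
    (1 + ‖x‖) ^ m * ‖f x‖ ≤ 2 ^ m * orderSeminorm E m f := by
  simpa using one_add_pow_mul_le_orderSeminorm le_rfl (Nat.zero_le m) f x

theorem continuous_orderSeminorm (m : ℕ) : Continuous (orderSeminorm E m) := by
  refine Seminorm.continuous_of_le (q := ∑ i ∈ Finset.Iic (m, m), schwartzSeminormFamily ℝ E ℂ i)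
    ?_ (Seminorm.finset_sup_le_sum _ _)
  refine Finset.sum_induction _ (fun q : Seminorm ℝ 𝓢(E, ℂ) => Continuous q)
    (fun q r hq hr => hq.add hr) continuous_const
    fun i _ => (schwartz_withSeminorms ℝ E ℂ).continuous_seminorm i

theorem exists_le_orderSeminorm (q : Seminorm ℝ 𝓢(E, ℂ)) (hq : Continuous q) :
    ∃ (m : ℕ) (C : ℝ), 0 ≤ C ∧ ∀ f, q f ≤ C * orderSeminorm E m f := by
  obtain ⟨s, C, -, h⟩ := Seminorm.bound_of_continuous (schwartz_withSeminorms ℝ E ℂ) q hq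
  refine ⟨s.sup fun i => max i.1 i.2, C, C.2, fun f => ?_⟩
  refine (h f).trans ?_
  rw [smul_apply, NNReal.smul_def, smul_eq_mul]
  refine mul_le_mul_of_nonneg_left ?_ C.2
  refine Seminorm.finset_sup_apply_le (apply_nonneg _ _) fun i hi => ?_
  have := Finset.le_sup (f := fun i : ℕ × ℕ => max i.1 i.2) hi
  exact seminorm_le_orderSeminorm (le_trans (le_max_left _ _) this)
    (le_trans (le_max_right _ _) this) f

theorem exists_orderSeminorm_map_le (A : 𝓢(E, ℂ) →L[ℝ] 𝓢(E', ℂ)) (m : ℕ) :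
    ∃ (m' : ℕ) (C : ℝ), 0 ≤ C ∧ ∀ f, orderSeminorm E' m (A f) ≤ C * orderSeminorm E m' f :=
  exists_le_orderSeminorm ((orderSeminorm E' m).comp A.toLinearMap)
    ((continuous_orderSeminorm m).comp A.continuous)

theorem tendsto_schwartz_iff {ι : Type*} {u : ι → 𝓢(E, ℂ)} {f : 𝓢(E, ℂ)} {a : Filter ι} :
    Tendsto u a (𝓝 f) ↔ ∀ m, Tendsto (fun i => orderSeminorm E m (u i - f)) a (𝓝 0) := by
  constructor
  · intro h m
    have h1 : Tendsto (fun i => u i - f) a (𝓝 0) := by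
      simpa using h.sub_const f
    have h2 := ((continuous_orderSeminorm (E := E) m).tendsto 0).comp h1
    rw [map_zero] at h2
    exact h2
  · intro h
    rw [(schwartz_withSeminorms ℝ E ℂ).tendsto_nhds]
    intro i ε hε
    filter_upwards [(h (max i.1 i.2)).eventually_lt_const hε] with j hj
    exact (seminorm_le_orderSeminorm (le_max_left _ _) (le_max_right _ _) _).trans_lt hj

theorem norm_iteratedFDeriv_compSubConstCLM (f : 𝓢(E, ℂ)) (l : ℕ) (a x : E) :
    iteratedFDeriv ℝ l (SchwartzMap.compSubConstCLM ℂ a f) x = iteratedFDeriv ℝ l f (x - a) := by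
  have : (SchwartzMap.compSubConstCLM ℂ a f : E → ℂ) = fun x => f (x - a) := rfl
  rw [this, iteratedFDeriv_comp_sub]

theorem orderSeminorm_compSubConstCLM_le (m : ℕ) (f : 𝓢(E, ℂ)) (a : E) :
    orderSeminorm E m (SchwartzMap.compSubConstCLM ℂ a f) ≤
      2 ^ m * (1 + ‖a‖) ^ m * orderSeminorm E m f := by
  refine orderSeminorm_le (by positivity) fun k hk l hl => ?_
  refine SchwartzMap.seminorm_le_bound ℝ k l _ (by positivity) fun x => ?_
  rw [norm_iteratedFDeriv_compSubConstCLM]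
  have h1 : ‖x‖ ≤ (1 + ‖a‖) * (1 + ‖x - a‖) := by
    have : ‖x‖ ≤ ‖x - a‖ + ‖a‖ := by simpa using norm_add_le (x - a) a
    nlinarith [norm_nonneg a, norm_nonneg (x - a)]
  calc ‖x‖ ^ k * ‖iteratedFDeriv ℝ l f (x - a)‖
      ≤ ((1 + ‖a‖) * (1 + ‖x - a‖)) ^ k * ‖iteratedFDeriv ℝ l f (x - a)‖ := by gcongr
    _ = (1 + ‖a‖) ^ k * ((1 + ‖x - a‖) ^ k * ‖iteratedFDeriv ℝ l f (x - a)‖) := by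
        rw [mul_pow]; ring
    _ ≤ (1 + ‖a‖) ^ m * (2 ^ m * orderSeminorm E m f) := by
        refine mul_le_mul (by gcongr; linarith [norm_nonneg a])
          (one_add_pow_mul_le_orderSeminorm hk hl f _) (by positivity) (by positivity)
    _ = _ := by ring

/-- Mean value inequality on the segment from x to x - h, which costs one derivative and hence the
order m + 1. The restriction ‖h‖ ≤ 1 keeps the polynomial weight comparable along the segment. -/
theorem orderSeminorm_compSubConstCLM_sub_le (m : ℕ) (f : 𝓢(E, ℂ)) {h : E} (hh : ‖h‖ ≤ 1) :
    orderSeminorm E m (SchwartzMap.compSubConstCLM ℂ h f - f) ≤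
      2 ^ m * 2 ^ (m + 1) * orderSeminorm E (m + 1) f * ‖h‖ := by
  refine orderSeminorm_le (by positivity) fun k hk l hl => ?_
  refine SchwartzMap.seminorm_le_bound ℝ k l _ (by positivity) fun x => ?_
  have e1 : iteratedFDeriv ℝ l (SchwartzMap.compSubConstCLM ℂ h f - f : 𝓢(E, ℂ)) x =
      iteratedFDeriv ℝ l f (x - h) - iteratedFDeriv ℝ l f x := by
    have : ((SchwartzMap.compSubConstCLM ℂ h f - f : 𝓢(E, ℂ)) : E → ℂ) =
      (SchwartzMap.compSubConstCLM ℂ h f : E → ℂ) - (f : E → ℂ) := rfl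
    rw [this, iteratedFDeriv_sub_apply, norm_iteratedFDeriv_compSubConstCLM]
    · exact (SchwartzMap.compSubConstCLM ℂ h f).contDiffAt l
    · exact f.contDiffAt l
  rw [e1]
  have hd : ∀ y ∈ segment ℝ x (x - h), ‖fderiv ℝ (iteratedFDeriv ℝ l f) y‖ ≤
      2 ^ k * (2 ^ (m + 1) * orderSeminorm E (m + 1) f) / (1 + ‖x‖) ^ k := by
    intro y hy
    rw [norm_fderiv_iteratedFDeriv, le_div_iff₀ (by positivity)]
    have h1 : ‖x - y‖ ≤ 1 := by
      have := norm_sub_le_of_mem_segment hy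
      have h2 : ‖y - x‖ ≤ ‖h‖ := by simpa using this
      rw [norm_sub_rev]; exact h2.trans hh
    have h2 : 1 + ‖x‖ ≤ 2 * (1 + ‖y‖) := by
      have : ‖x‖ ≤ ‖x - y‖ + ‖y‖ := by simpa using norm_add_le (x - y) y
      linarith [norm_nonneg y]
    calc ‖iteratedFDeriv ℝ (l + 1) f y‖ * (1 + ‖x‖) ^ k
        ≤ ‖iteratedFDeriv ℝ (l + 1) f y‖ * (2 * (1 + ‖y‖)) ^ k := by gcongr
      _ = 2 ^ k * ((1 + ‖y‖) ^ k * ‖iteratedFDeriv ℝ (l + 1) f y‖) := by rw [mul_pow]; ring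
      _ ≤ _ := by
        exact mul_le_mul_of_nonneg_left
          (one_add_pow_mul_le_orderSeminorm (by omega) (by omega) f y) (by positivity)
  have h3 := (convex_segment x (x - h)).norm_image_sub_le_of_norm_fderiv_le (𝕜 := ℝ)
    (f := iteratedFDeriv ℝ l f)
    (fun y _ => ((f.smooth ⊤).differentiable_iteratedFDeriv (m := l) (by
      exact_mod_cast WithTop.coe_lt_top _)).differentiableAt) hd
    (left_mem_segment ℝ x (x - h)) (right_mem_segment ℝ x (x - h))
  have h4 : ‖x - h - x‖ = ‖h‖ := by simp
  rw [h4] at h3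
  calc ‖x‖ ^ k * ‖iteratedFDeriv ℝ l f (x - h) - iteratedFDeriv ℝ l f x‖
      ≤ (1 + ‖x‖) ^ k *
        (2 ^ k * (2 ^ (m + 1) * orderSeminorm E (m + 1) f) / (1 + ‖x‖) ^ k * ‖h‖) := by
        gcongr
        linarith [norm_nonneg x]
    _ = 2 ^ k * 2 ^ (m + 1) * orderSeminorm E (m + 1) f * ‖h‖ := by
        field_simp
    _ ≤ _ := by
        gcongr
        norm_num

theorem continuous_compSubConstCLM (f : 𝓢(E, ℂ)) :
    Continuous fun a : E => SchwartzMap.compSubConstCLM ℂ a f := by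
  rw [continuous_iff_continuousAt]
  intro a
  rw [ContinuousAt, tendsto_schwartz_iff]
  intro m
  have e : ∀ b : E, SchwartzMap.compSubConstCLM ℂ b f - SchwartzMap.compSubConstCLM ℂ a f =
      SchwartzMap.compSubConstCLM ℂ (b - a) (SchwartzMap.compSubConstCLM ℂ a f) -
        SchwartzMap.compSubConstCLM ℂ a f := by
    intro b; rw [SchwartzMap.compSubConstCLM_comp]; simp
  have hlim : Tendsto (fun b : E => 2 ^ m * 2 ^ (m + 1) *
      orderSeminorm E (m + 1) (SchwartzMap.compSubConstCLM ℂ a f) * ‖b - a‖) (𝓝 a) (𝓝 0) := by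
    have : Continuous (fun b : E => 2 ^ m * 2 ^ (m + 1) *
      orderSeminorm E (m + 1) (SchwartzMap.compSubConstCLM ℂ a f) * ‖b - a‖) := by fun_prop
    simpa using this.tendsto a
  refine squeeze_zero' (Eventually.of_forall fun b => apply_nonneg _ _) ?_ hlim
  filter_upwards [Metric.ball_mem_nhds a one_pos] with b hb
  rw [e]
  refine orderSeminorm_compSubConstCLM_sub_le m _ ?_
  rw [Metric.mem_ball, dist_eq_norm] at hb
  exact hb.le

end OrderSeminorm

/-! ### Time-frequency shifts in the Schwartz topology -/

section TimeFrequency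

variable {n : ℕ}

local notation "V" => EuclideanSpace ℝ (Fin n)

theorem fourier_timeFreqShift_zero (ξ : V) (φ : 𝓢(V, ℂ)) :
    𝓕 (timeFreqShift 0 ξ φ) = SchwartzMap.compSubConstCLM ℂ ξ (𝓕 φ) := by
  ext η
  rw [SchwartzMap.compSubConstCLM_apply, SchwartzMap.fourier_coe, SchwartzMap.fourier_coe,
    Real.fourier_eq', Real.fourier_eq']
  congr 1
  ext t
  rw [timeFreqShift_apply, smul_eq_mul, smul_eq_mul, ← mul_assoc, ← Complex.exp_add, sub_zero]
  congr 2
  rw [inner_sub_right]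
  push_cast
  ring

/-- The Fourier transform conjugates modulation to translation, so bounds and continuity for
modulations follow from those for translations, without differentiating characters. -/
theorem timeFreqShift_eq (x ξ : V) (φ : 𝓢(V, ℂ)) :
    timeFreqShift x ξ φ =
      𝓕⁻ (SchwartzMap.compSubConstCLM ℂ ξ (𝓕 (SchwartzMap.compSubConstCLM ℂ x φ))) := by
  rw [← fourier_timeFreqShift_zero, FourierTransform.fourierInv_fourier_eq]
  ext t
  simp [timeFreqShift_apply]

theorem exists_orderSeminorm_modulation_le (m : ℕ) :
    ∃ (N : ℕ) (C : ℝ), 0 ≤ C ∧ ∀ (ξ : V) (g : 𝓢(V, ℂ)),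
      orderSeminorm V m (𝓕⁻ (SchwartzMap.compSubConstCLM ℂ ξ (𝓕 g))) ≤
        C * (1 + ‖ξ‖) ^ N * orderSeminorm V N g := by
  obtain ⟨m₁, C₁, hC₁, h₁⟩ := exists_orderSeminorm_map_le
    ((fourierInvCLM ℂ 𝓢(V, ℂ)).restrictScalars ℝ) m
  obtain ⟨m₂, C₂, hC₂, h₂⟩ := exists_orderSeminorm_map_le
    ((fourierCLM ℂ 𝓢(V, ℂ)).restrictScalars ℝ) m₁
  refine ⟨max m₁ m₂, C₁ * 2 ^ m₁ * C₂, by positivity, fun ξ g => ?_⟩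
  have hmono : orderSeminorm V m₂ g ≤ orderSeminorm V (max m₁ m₂) g :=
    orderSeminorm_le (apply_nonneg _ _) fun k hk l hl =>
      seminorm_le_orderSeminorm (hk.trans (le_max_right _ _)) (hl.trans (le_max_right _ _)) g
  calc orderSeminorm V m (𝓕⁻ (SchwartzMap.compSubConstCLM ℂ ξ (𝓕 g)))
      ≤ C₁ * orderSeminorm V m₁ (SchwartzMap.compSubConstCLM ℂ ξ (𝓕 g)) := h₁ _
    _ ≤ C₁ * (2 ^ m₁ * (1 + ‖ξ‖) ^ m₁ * orderSeminorm V m₁ (𝓕 g)) := by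
        gcongr; exact orderSeminorm_compSubConstCLM_le _ _ _
    _ ≤ C₁ * (2 ^ m₁ * (1 + ‖ξ‖) ^ (max m₁ m₂) * (C₂ * orderSeminorm V (max m₁ m₂) g)) := by
        gcongr
        · linarith [norm_nonneg ξ]
        · exact le_max_left _ _
        · exact (h₂ g).trans (by gcongr)
    _ = _ := by ring

theorem exists_orderSeminorm_timeFreqShift_le (φ : 𝓢(V, ℂ)) (m : ℕ) :
    ∃ (N : ℕ) (C : ℝ), 0 ≤ C ∧ ∀ x ξ : V,
      orderSeminorm V m (conjSchwartz (timeFreqShift x ξ φ)) ≤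
        C * (1 + ‖x‖) ^ N * (1 + ‖ξ‖) ^ N := by
  obtain ⟨m₁, C₁, hC₁, h₁⟩ := exists_orderSeminorm_map_le
    (SchwartzMap.postcompCLM (E := V) (𝕜 := ℝ) (Complex.conjCLE : ℂ →L[ℝ] ℂ)) m
  obtain ⟨N, C, hC, h⟩ := exists_orderSeminorm_modulation_le (n := n) m₁
  refine ⟨N, C₁ * C * 2 ^ N * orderSeminorm V N φ, by positivity, fun x ξ => ?_⟩
  calc orderSeminorm V m (conjSchwartz (timeFreqShift x ξ φ))
      ≤ C₁ * orderSeminorm V m₁ (timeFreqShift x ξ φ) := h₁ _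
    _ ≤ C₁ * (C * (1 + ‖ξ‖) ^ N * orderSeminorm V N (SchwartzMap.compSubConstCLM ℂ x φ)) := by
        rw [timeFreqShift_eq]; gcongr; exact h _ _
    _ ≤ C₁ * (C * (1 + ‖ξ‖) ^ N * (2 ^ N * (1 + ‖x‖) ^ N * orderSeminorm V N φ)) := by
        gcongr; exact orderSeminorm_compSubConstCLM_le _ _ _
    _ = _ := by ring

theorem continuous_timeFreqShift (φ : 𝓢(V, ℂ)) :
    Continuous fun z : V × V => timeFreqShift z.1 z.2 φ := by
  rw [continuous_iff_continuousAt]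
  rintro ⟨a, b⟩
  rw [ContinuousAt, tendsto_schwartz_iff]
  intro m
  obtain ⟨N, C, hC, h⟩ := exists_orderSeminorm_modulation_le (n := n) m
  set T : V → 𝓢(V, ℂ) → 𝓢(V, ℂ) := fun a f => SchwartzMap.compSubConstCLM ℂ a f with hT
  -- Vary x first, under a modulation bounded locally uniformly in ξ, and then vary ξ with the
  -- function T_a φ fixed.
  have e : ∀ x ξ : V, timeFreqShift x ξ φ - timeFreqShift a b φ =
      𝓕⁻ (T ξ (𝓕 (T x φ - T a φ))) + (𝓕⁻ (T ξ (𝓕 (T a φ))) - 𝓕⁻ (T b (𝓕 (T a φ)))) := by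
    intro x ξ
    rw [timeFreqShift_eq, timeFreqShift_eq]
    have : 𝓕⁻ (T ξ (𝓕 (T x φ - T a φ))) = 𝓕⁻ (T ξ (𝓕 (T x φ))) - 𝓕⁻ (T ξ (𝓕 (T a φ))) := by
      have h1 : ∀ g h : 𝓢(V, ℂ), 𝓕 (g - h) = 𝓕 g - 𝓕 h := (fourierCLM ℂ 𝓢(V, ℂ)).map_sub
      have h2 : ∀ g h : 𝓢(V, ℂ), 𝓕⁻ (g - h) = 𝓕⁻ g - 𝓕⁻ h := (fourierInvCLM ℂ 𝓢(V, ℂ)).map_sub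
      simp only [hT, h1, map_sub, h2]
    rw [this]
    abel
  have l1 : Tendsto (fun z : V × V => C * (1 + ‖z.2‖) ^ N * orderSeminorm V N (T z.1 φ - T a φ))
      (𝓝 (a, b)) (𝓝 0) := by
    have c1 : Continuous fun z : V × V =>
        C * (1 + ‖z.2‖) ^ N * orderSeminorm V N (T z.1 φ - T a φ) := by
      refine (by fun_prop : Continuous fun z : V × V => C * (1 + ‖z.2‖) ^ N).mul ?_
      refine (continuous_orderSeminorm N).comp ?_
      exact ((continuous_compSubConstCLM φ).comp continuous_fst).sub continuous_const
    simpa using c1.tendsto (a, b)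
  have l2 : Tendsto (fun z : V × V =>
      orderSeminorm V m (𝓕⁻ (T z.2 (𝓕 (T a φ))) - 𝓕⁻ (T b (𝓕 (T a φ))))) (𝓝 (a, b)) (𝓝 0) := by
    have c1 : Continuous fun z : V × V =>
        orderSeminorm V m (𝓕⁻ (T z.2 (𝓕 (T a φ))) - 𝓕⁻ (T b (𝓕 (T a φ)))) := by
      refine (continuous_orderSeminorm m).comp ?_
      refine Continuous.sub ?_ continuous_const
      refine (fourierInvCLM ℂ 𝓢(V, ℂ)).continuous.comp ?_
      exact (continuous_compSubConstCLM _).comp continuous_snd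
    simpa using c1.tendsto (a, b)
  refine squeeze_zero (fun z => apply_nonneg _ _) (fun z => ?_) (by simpa using l1.add l2)
  rw [e]
  refine (map_add_le_add _ _ _).trans ?_
  gcongr
  exact h _ _

theorem continuous_conjSchwartz_timeFreqShift (φ : 𝓢(V, ℂ)) :
    Continuous fun z : V × V => conjSchwartz (timeFreqShift z.1 z.2 φ) :=
  (SchwartzMap.postcompCLM (E := V) (𝕜 := ℝ) (Complex.conjCLE : ℂ →L[ℝ] ℂ)).continuous.comp
    (continuous_timeFreqShift φ)

theorem continuous_gaborTransform (φ : 𝓢(V, ℂ)) (f : 𝓢'(V, ℂ)) :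
    Continuous fun z : V × V => gaborTransform φ f z.1 z.2 :=
  f.continuous.comp (continuous_conjSchwartz_timeFreqShift φ)

end TimeFrequency

/-! ### Tempered distributions and Schwartz-valued integrals -/

section Interchange

variable {Z : Type*} {E : Type} [TopologicalSpace Z] [NormedAddCommGroup E] [NormedSpace ℝ E]

theorem continuous_schwartz_apply {F : Type*} [NormedAddCommGroup F] [NormedSpace ℝ F]
    {H : Z → 𝓢(E, F)} (hc : Continuous H) (x : E) : Continuous fun z => H z x :=
  ((BoundedContinuousFunction.evalCLM ℝ x).comp
    (SchwartzMap.toBoundedContinuousFunctionCLM ℝ E F)).continuous.comp hc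

theorem seminorm_fderivCLM {F : Type*} [NormedAddCommGroup F] [NormedSpace ℝ F]
    (f : 𝓢(E, F)) (k l : ℕ) :
    SchwartzMap.seminorm ℝ k l (SchwartzMap.fderivCLM ℝ E F f) ≤
      SchwartzMap.seminorm ℝ k (l + 1) f := by
  refine SchwartzMap.seminorm_le_bound ℝ k l _ (apply_nonneg _ _) fun x => ?_
  have : (SchwartzMap.fderivCLM ℝ E F f : E → E →L[ℝ] F) = fderiv ℝ f := rfl
  rw [this, norm_iteratedFDeriv_fderiv]
  exact SchwartzMap.le_seminorm ℝ k (l + 1) f x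

variable [SecondCountableTopology Z] [MeasurableSpace Z] [OpensMeasurableSpace Z] {μ : Measure Z}

theorem integrable_schwartz_apply {F : Type*} [NormedAddCommGroup F] [NormedSpace ℝ F]
    {H : Z → 𝓢(E, F)} (hc : Continuous H)
    (hi : Integrable (fun z => SchwartzMap.seminorm ℝ 0 0 (H z)) μ) (x : E) :
    Integrable (fun z => H z x) μ :=
  hi.mono' (continuous_schwartz_apply hc x).aestronglyMeasurable
    (Eventually.of_forall fun z => SchwartzMap.norm_le_seminorm ℝ (H z) x)

theorem hasFDerivAt_integral_schwartz {F : Type*} [NormedAddCommGroup F] [NormedSpace ℝ F]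
    {H : Z → 𝓢(E, F)} (hc : Continuous H)
    (hi : ∀ l, Integrable (fun z => SchwartzMap.seminorm ℝ 0 l (H z)) μ) (x : E) :
    HasFDerivAt (fun x => ∫ z, H z x ∂μ) (∫ z, SchwartzMap.fderivCLM ℝ E F (H z) x ∂μ) x := by
  refine hasFDerivAt_integral_of_dominated_of_fderiv_le (F := fun x z => H z x)
    (F' := fun x z => SchwartzMap.fderivCLM ℝ E F (H z) x)
    (bound := fun z => SchwartzMap.seminorm ℝ 0 1 (H z)) univ_mem
    (Eventually.of_forall fun y => (continuous_schwartz_apply hc y).aestronglyMeasurable)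
    (integrable_schwartz_apply hc (hi 0) x)
    (continuous_schwartz_apply ((SchwartzMap.fderivCLM ℝ E F).continuous.comp hc)
      x).aestronglyMeasurable
    (Eventually.of_forall fun z y _ => ?_) (hi 1)
    (Eventually.of_forall fun z y _ => (H z).hasFDerivAt y)
  exact (SchwartzMap.norm_le_seminorm ℝ _ y).trans (seminorm_fderivCLM (H z) 0 0)

/-- Induction on l with the codomain generalized: the step replaces `F` by `E →L[ℝ] F`, so both have
to live in one universe. -/
theorem iteratedFDeriv_integral_schwartz (l : ℕ) {F : Type} [NormedAddCommGroup F]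
    [NormedSpace ℝ F] {H : Z → 𝓢(E, F)} (hc : Continuous H)
    (hi : ∀ l, Integrable (fun z => SchwartzMap.seminorm ℝ 0 l (H z)) μ) (x : E) :
    iteratedFDeriv ℝ l (fun x => ∫ z, H z x ∂μ) x = ∫ z, iteratedFDeriv ℝ l (H z) x ∂μ := by
  induction l generalizing F x with
  | zero =>
    simp only [iteratedFDeriv_zero_eq_comp, Function.comp_apply]
    exact (ContinuousLinearEquiv.integral_comp_comm
      (continuousMultilinearCurryFin0 ℝ E F).symm.toContinuousLinearEquiv (fun z => H z x)).symm
  | succ l ih =>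
    have hd : (fun y => fderiv ℝ (fun x => ∫ z, H z x ∂μ) y) =
        fun y => ∫ z, SchwartzMap.fderivCLM ℝ E F (H z) y ∂μ :=
      funext fun y => (hasFDerivAt_integral_schwartz hc hi y).fderiv
    rw [iteratedFDeriv_succ_eq_comp_right, Function.comp_apply, hd,
      ih (H := fun z => SchwartzMap.fderivCLM ℝ E F (H z))
      ((SchwartzMap.fderivCLM ℝ E F).continuous.comp hc) fun l => ?_]
    · simp only [iteratedFDeriv_succ_eq_comp_right, Function.comp_apply]
      exact (ContinuousLinearEquiv.integral_comp_comm
        (continuousMultilinearCurryRightEquiv' ℝ l E F).symm.toContinuousLinearEquiv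
        (fun z => iteratedFDeriv ℝ l (fun y => fderiv ℝ (H z) y) x)).symm
    · refine (hi (l + 1)).mono' ?_ (Eventually.of_forall fun z => ?_)
      · exact (((schwartz_withSeminorms ℝ E (E →L[ℝ] F)).continuous_seminorm (0, l)).comp
          ((SchwartzMap.fderivCLM ℝ E F).continuous.comp hc)).aestronglyMeasurable
      · rw [Real.norm_of_nonneg (apply_nonneg _ _)]
        exact seminorm_fderivCLM (H z) 0 l

/-- Bounded continuous functions with values in the `l`-linear forms. -/
abbrev BoundedForms (E : Type) [NormedAddCommGroup E] [NormedSpace ℝ E] (l : ℕ) :=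
  @BoundedContinuousFunction E (E [×l]→L[ℝ] ℂ) _ SeminormedAddCommGroup.toPseudoMetricSpace

/-- The weighted derivatives `x ↦ ‖x‖ᵏ Dˡ f(x)` as bounded continuous functions. -/
def weightedDeriv (E : Type) [NormedAddCommGroup E] [NormedSpace ℝ E] (k l : ℕ) :
    𝓢(E, ℂ) →ₗ[ℂ] BoundedForms E l where
  toFun f := BoundedContinuousFunction.ofNormedAddCommGroup
    (fun x => ‖x‖ ^ k • iteratedFDeriv ℝ l f x)
    ((continuous_norm.pow k).smul ((f.smooth ⊤).continuous_iteratedFDeriv (m := l)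
      (by exact_mod_cast le_top)))
    (SchwartzMap.seminorm ℝ k l f) (fun x => by
      rw [norm_smul, norm_pow, norm_norm]
      exact SchwartzMap.le_seminorm ℝ k l f x)
  map_add' f g := by
    ext1 x
    have : ((f + g : 𝓢(E, ℂ)) : E → ℂ) = (f : E → ℂ) + g := rfl
    simp [this, iteratedFDeriv_add_apply (f.contDiffAt l) (g.contDiffAt l)]
  map_smul' c f := by
    ext1 x
    have : ((c • f : 𝓢(E, ℂ)) : E → ℂ) = c • (f : E → ℂ) := rfl
    simp [this, iteratedFDeriv_const_smul_apply (f.contDiffAt l), smul_comm c]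

theorem weightedDeriv_apply (k l : ℕ) (f : 𝓢(E, ℂ)) (x : E) :
    weightedDeriv E k l f x = ‖x‖ ^ k • iteratedFDeriv ℝ l f x := rfl

theorem norm_weightedDeriv (k l : ℕ) (f : 𝓢(E, ℂ)) :
    ‖weightedDeriv E k l f‖ = SchwartzMap.seminorm ℝ k l f := by
  apply le_antisymm
  · exact BoundedContinuousFunction.norm_ofNormedAddCommGroup_le _ (apply_nonneg _ _) fun x => by
      rw [norm_smul, norm_pow, norm_norm]
      exact SchwartzMap.le_seminorm ℝ k l f x
  · refine SchwartzMap.seminorm_le_bound ℝ k l f (norm_nonneg _) fun x => ?_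
    have := (weightedDeriv E k l f).norm_coe_le_norm x
    rwa [weightedDeriv_apply, norm_smul, norm_pow, norm_norm] at this

/-- The Banach space of families of weighted derivatives of order at most `(m, m)`. -/
def JetSpace (E : Type) [NormedAddCommGroup E] [NormedSpace ℝ E] (m : ℕ) :=
  (i : Finset.Iic (m, m)) → BoundedForms E i.1.2

instance (m : ℕ) : NormedAddCommGroup (JetSpace E m) :=
  inferInstanceAs (NormedAddCommGroup ((i : Finset.Iic (m, m)) → BoundedForms E i.1.2))

instance (m : ℕ) : NormedSpace ℂ (JetSpace E m) :=
  inferInstanceAs (NormedSpace ℂ ((i : Finset.Iic (m, m)) → BoundedForms E i.1.2))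

instance (m : ℕ) : CompleteSpace (JetSpace E m) :=
  inferInstanceAs (CompleteSpace ((i : Finset.Iic (m, m)) → BoundedForms E i.1.2))

/-- All weighted derivatives of order at most `(m, m)`. -/
def jetMap (E : Type) [NormedAddCommGroup E] [NormedSpace ℝ E] (m : ℕ) :
    𝓢(E, ℂ) →ₗ[ℂ] JetSpace E m :=
  LinearMap.pi fun i => weightedDeriv E i.1.1 i.1.2

/-- The evaluation of one component of a family of weighted derivatives at a point. -/
def jetEval (m : ℕ) (i : Finset.Iic (m, m)) (x : E) : JetSpace E m →L[ℂ] (E [×i.1.2]→L[ℝ] ℂ) :=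
  LinearMap.mkContinuous
    { toFun := fun J => J i x
      map_add' := fun _ _ => rfl
      map_smul' := fun _ _ => rfl } 1 fun J => by
    rw [one_mul]
    exact ((J i).norm_coe_le_norm x).trans
      (norm_le_pi_norm (show (i : Finset.Iic (m, m)) → BoundedForms E i.1.2 from J) i)

theorem norm_jetMap (m : ℕ) (f : 𝓢(E, ℂ)) : ‖jetMap E m f‖ = orderSeminorm E m f := by
  apply le_antisymm
  · refine (pi_norm_le_iff_of_nonneg (apply_nonneg _ _)).2 fun i => ?_
    have := Finset.mem_Iic.1 i.2
    exact (norm_weightedDeriv _ _ f).trans_le (seminorm_le_orderSeminorm this.1 this.2 f)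
  · refine orderSeminorm_le (norm_nonneg _) fun k hk l hl => ?_
    rw [← norm_weightedDeriv]
    exact norm_le_pi_norm (show (i : Finset.Iic (m, m)) → BoundedForms E i.1.2 from
      jetMap E m f) ⟨(k, l), Finset.mem_Iic.2 ⟨hk, hl⟩⟩

theorem jetMap_injective (m : ℕ) : Function.Injective (jetMap E m) := by
  rw [← LinearMap.ker_eq_bot, LinearMap.ker_eq_bot']
  intro f hf
  have h0 : orderSeminorm E m f = 0 := by rw [← norm_jetMap, hf, norm_zero]
  ext x
  have := SchwartzMap.norm_le_seminorm ℝ f x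
  have h1 := seminorm_le_orderSeminorm (Nat.zero_le m) (Nat.zero_le m) f
  rw [h0] at h1
  simpa using this.trans h1

/-- A tempered distribution factors through finitely many weighted derivatives. -/
theorem exists_eq_comp_jetMap (f : 𝓢'(E, ℂ)) :
    ∃ (m : ℕ) (F : StrongDual ℂ (JetSpace E m)), ∀ g, f g = F (jetMap E m g) := by
  obtain ⟨m, C, hC, hb⟩ := exists_le_orderSeminorm
    ((normSeminorm ℝ ℂ).comp ((f : 𝓢(E, ℂ) →ₗ[ℂ] ℂ).restrictScalars ℝ))
    (continuous_norm.comp f.continuous)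
  -- On the range of `jetMap` the distribution is a functional bounded by C, because the jet norm is
  -- the order seminorm. Hahn–Banach extends it to the whole Banach space, where Bochner integrals
  -- commute with it.
  let e := LinearEquiv.ofInjective (jetMap E m) (jetMap_injective m)
  let f₀ : StrongDual ℂ (LinearMap.range (jetMap E m)) :=
    ((f : 𝓢(E, ℂ) →ₗ[ℂ] ℂ).comp (e.symm : _ →ₗ[ℂ] 𝓢(E, ℂ))).mkContinuous C fun y => by
      have h1 : ((e (e.symm y) : LinearMap.range (jetMap E m)) : _) = jetMap E m (e.symm y) := rfl
      rw [LinearEquiv.apply_symm_apply] at h1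
      have h2 := hb (e.symm y)
      rw [← norm_jetMap, ← h1] at h2
      exact h2
  obtain ⟨F, hF, -⟩ := exists_extension_norm_eq (LinearMap.range (jetMap E m)) f₀
  refine ⟨m, F, fun g => ?_⟩
  have h := hF (e g)
  have h1 : f₀ (e g) = f g := by
    change f (e.symm (e g)) = f g
    rw [LinearEquiv.symm_apply_apply]
  rw [← h1, ← h]
  rfl

/-- Tempered distributions commute with Schwartz-valued integrals. -/
theorem temperedDistribution_integral {H : Z → 𝓢(E, ℂ)} (hc : Continuous H)
    (hi : ∀ m, Integrable (fun z => orderSeminorm E m (H z)) μ) {g : 𝓢(E, ℂ)}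
    (hg : ∀ x, g x = ∫ z, H z x ∂μ) (f : 𝓢'(E, ℂ)) : f g = ∫ z, f (H z) ∂μ := by
  obtain ⟨m, F, hF⟩ := exists_eq_comp_jetMap f
  have hcJ : Continuous fun z => jetMap E m (H z) := by
    rw [continuous_iff_continuousAt]
    intro z₀
    rw [ContinuousAt, tendsto_iff_norm_sub_tendsto_zero]
    simp only [← map_sub, norm_jetMap]
    exact tendsto_schwartz_iff.1 (hc.tendsto z₀) m
  have hi' : ∀ k l, Integrable (fun z => SchwartzMap.seminorm ℝ k l (H z)) μ := fun k l => by
    refine (hi (max k l)).mono' (((schwartz_withSeminorms ℝ E ℂ).continuous_seminorm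
      (k, l)).comp hc).aestronglyMeasurable (Eventually.of_forall fun z => ?_)
    rw [Real.norm_of_nonneg (apply_nonneg _ _)]
    exact seminorm_le_orderSeminorm (le_max_left _ _) (le_max_right _ _) _
  have hiJ : Integrable (fun z => jetMap E m (H z)) μ := by
    refine (hi m).mono' hcJ.aestronglyMeasurable (Eventually.of_forall fun z => ?_)
    rw [norm_jetMap]
  -- An identity of jets may be checked after the evaluations `jetEval`, which turn it into
  -- differentiation under the integral sign.
  have hgJ : jetMap E m g = ∫ z, jetMap E m (H z) ∂μ := by
    funext i
    refine BoundedContinuousFunction.ext fun x => ?_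
    refine Eq.trans ?_ ((jetEval m i x).integral_comp_comm hiJ)
    change ‖x‖ ^ i.1.1 • iteratedFDeriv ℝ i.1.2 g x =
      ∫ z, ‖x‖ ^ i.1.1 • iteratedFDeriv ℝ i.1.2 (H z) x ∂μ
    rw [integral_smul, ← iteratedFDeriv_integral_schwartz _ hc (hi' 0)]
    congr 2
    exact funext hg
  rw [hF, hgJ, ← F.integral_comp_comm hiJ]
  simp only [hF]

end Interchange

/-! ### Rapid decay and covariance of the Gabor transform of Schwartz functions -/

section Decay

variable {n : ℕ}

local notation "V" => EuclideanSpace ℝ (Fin n)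

theorem integrable_one_add_norm_pow_mul (g : 𝓢(V, ℂ)) (N : ℕ) :
    Integrable fun t => (1 + ‖t‖) ^ N * ‖g t‖ := by
  have hD : (Module.finrank ℝ V : ℝ) < (n + 1 : ℕ) := by simp
  have h1 := (integrable_one_add_norm (E := V) (μ := volume) hD).const_mul
    (2 ^ (N + (n + 1)) * orderSeminorm V (N + (n + 1)) g)
  refine h1.mono' (by fun_prop) (Eventually.of_forall fun t => ?_)
  have h2 := one_add_pow_mul_norm_le_orderSeminorm (N + (n + 1)) g t
  rw [Real.norm_of_nonneg (by positivity), Real.rpow_neg (by positivity), Real.rpow_natCast,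
    ← div_eq_mul_inv, le_div_iff₀ (by positivity)]
  refine le_trans (le_of_eq ?_) h2
  rw [pow_add (1 + ‖t‖) N (n + 1)]; ring

theorem exists_one_add_norm_pow_mul_integral_le (g φ : 𝓢(V, ℂ)) (N : ℕ) :
    ∃ C : ℝ, 0 ≤ C ∧ ∀ x : V, (1 + ‖x‖) ^ N * ∫ t, ‖φ (t - x)‖ * ‖g t‖ ≤ C := by
  refine ⟨(2 ^ N * orderSeminorm V N φ) * ∫ t, (1 + ‖t‖) ^ N * ‖g t‖, by positivity, fun x => ?_⟩
  rw [← integral_const_mul, ← integral_const_mul]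
  refine integral_mono_of_nonneg (Eventually.of_forall fun t => by positivity)
    ((integrable_one_add_norm_pow_mul g N).const_mul _) (Eventually.of_forall fun t => ?_)
  have h1 : 1 + ‖x‖ ≤ (1 + ‖t - x‖) * (1 + ‖t‖) := by
    have : ‖x‖ ≤ ‖t‖ + ‖t - x‖ := by simpa using norm_sub_le t (t - x)
    nlinarith [norm_nonneg t, norm_nonneg (t - x)]
  calc (1 + ‖x‖) ^ N * (‖φ (t - x)‖ * ‖g t‖)
      ≤ ((1 + ‖t - x‖) * (1 + ‖t‖)) ^ N * (‖φ (t - x)‖ * ‖g t‖) := by gcongr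
    _ = ((1 + ‖t - x‖) ^ N * ‖φ (t - x)‖) * ((1 + ‖t‖) ^ N * ‖g t‖) := by rw [mul_pow]; ring
    _ ≤ _ := mul_le_mul_of_nonneg_right (one_add_pow_mul_norm_le_orderSeminorm N φ _)
      (by positivity)

/-- The Gabor transform of a Schwartz function. -/
def schwartzGabor (φ g : 𝓢(V, ℂ)) (x ξ : V) : ℂ :=
  gaborTransform φ (SchwartzMap.toTemperedDistributionCLM V ℂ volume g) x ξ

theorem schwartzGabor_eq_integral (φ g : 𝓢(V, ℂ)) (x ξ : V) :
    schwartzGabor φ g x ξ = ∫ t, conj (timeFreqShift x ξ φ t) * g t := by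
  simp [schwartzGabor, gaborTransform, conjSchwartz_apply]

theorem continuous_schwartzGabor (φ g : 𝓢(V, ℂ)) :
    Continuous fun z : V × V => schwartzGabor φ g z.1 z.2 :=
  continuous_gaborTransform φ _

theorem norm_timeFreqShift_apply (x ξ t : V) (φ : 𝓢(V, ℂ)) :
    ‖timeFreqShift x ξ φ t‖ = ‖φ (t - x)‖ := by
  rw [timeFreqShift_apply, norm_mul, mul_comm Complex.I, Complex.norm_exp_ofReal_mul_I, one_mul]

theorem norm_schwartzGabor_le (φ g : 𝓢(V, ℂ)) (x ξ : V) :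
    ‖schwartzGabor φ g x ξ‖ ≤ ∫ t, ‖φ (t - x)‖ * ‖g t‖ := by
  rw [schwartzGabor_eq_integral]
  refine (norm_integral_le_integral_norm _).trans_eq ?_
  simp only [norm_mul, RCLike.norm_conj, norm_timeFreqShift_apply]

theorem norm_fourier_timeFreqShift (x ξ η : V) (φ : 𝓢(V, ℂ)) :
    ‖𝓕 (timeFreqShift x ξ φ) η‖ = ‖𝓕 φ (η - ξ)‖ := by
  rw [timeFreqShift_eq, FourierTransform.fourier_fourierInv_eq, SchwartzMap.compSubConstCLM_apply,
    SchwartzMap.fourier_coe, SchwartzMap.fourier_coe]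
  have h := congrFun (VectorFourier.fourierIntegral_comp_add_right Real.fourierChar volume
    (innerₗ V) (φ : V → ℂ) (-x)) (η - ξ)
  have h2 : (SchwartzMap.compSubConstCLM ℂ x φ : V → ℂ) = (φ : V → ℂ) ∘ fun v => v + -x := by
    ext v; simp [sub_eq_add_neg]
  rw [h2]
  refine (congrArg norm h).trans ?_
  rw [Circle.norm_smul]
  rfl

/-- Parseval exchanges the roles of position and frequency. This bound yields decay in ξ, as
`norm_schwartzGabor_le` yields decay in x. -/
theorem norm_schwartzGabor_le_fourier (φ g : 𝓢(V, ℂ)) (x ξ : V) :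
    ‖schwartzGabor φ g x ξ‖ ≤ ∫ t, ‖𝓕 φ (t - ξ)‖ * ‖𝓕 g t‖ := by
  have h := SchwartzMap.integral_inner_fourier_fourier (timeFreqShift x ξ φ) g
  have h2 : schwartzGabor φ g x ξ = ∫ t, conj (𝓕 (timeFreqShift x ξ φ) t) * 𝓕 g t := by
    rw [schwartzGabor_eq_integral]
    simpa [RCLike.inner_apply, mul_comm] using h.symm
  rw [h2]
  refine (norm_integral_le_integral_norm _).trans_eq ?_
  simp only [norm_mul, RCLike.norm_conj, norm_fourier_timeFreqShift]

/-- Decay in x alone and in ξ alone is enough: the estimate used is the one for the larger of the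
two variables. -/
theorem exists_one_add_norm_pow_mul_schwartzGabor_le (φ g : 𝓢(V, ℂ)) (N : ℕ) :
    ∃ C : ℝ, 0 ≤ C ∧ ∀ x ξ : V,
      (1 + max ‖x‖ ‖ξ‖) ^ N * ‖schwartzGabor φ g x ξ‖ ≤ C := by
  obtain ⟨C₁, h₁, H₁⟩ := exists_one_add_norm_pow_mul_integral_le g φ N
  obtain ⟨C₂, h₂, H₂⟩ := exists_one_add_norm_pow_mul_integral_le (𝓕 g) (𝓕 φ) N
  refine ⟨max C₁ C₂, le_max_of_le_left h₁, fun x ξ => ?_⟩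
  rcases le_total ‖x‖ ‖ξ‖ with h | h
  · rw [max_eq_right h]
    refine le_max_of_le_right (le_trans ?_ (H₂ ξ))
    gcongr
    exact norm_schwartzGabor_le_fourier φ g x ξ
  · rw [max_eq_left h]
    refine le_max_of_le_left (le_trans ?_ (H₁ x))
    gcongr
    exact norm_schwartzGabor_le φ g x ξ

/-- Covariance: substituting t + a for t moves the shift to the window, up to a factor of modulus
one. It is what turns the reproducing formula into a convolution bound. -/
theorem norm_schwartzGabor_timeFreqShift (φ ψ : 𝓢(V, ℂ)) (a b x ξ : V) :
    ‖schwartzGabor φ (timeFreqShift a b ψ) x ξ‖ = ‖schwartzGabor φ ψ (x - a) (ξ - b)‖ := by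
  have h : schwartzGabor φ (timeFreqShift a b ψ) x ξ =
      Complex.exp (((2 * Real.pi * inner ℝ a (b - ξ) : ℝ) : ℂ) * Complex.I) *
        schwartzGabor φ ψ (x - a) (ξ - b) := by
    rw [schwartzGabor_eq_integral, schwartzGabor_eq_integral, ← integral_const_mul,
      ← integral_add_right_eq_self _ a]
    congr 1
    ext t
    simp only [timeFreqShift_apply, map_mul, ← Complex.exp_conj, Complex.conj_I,
      Complex.conj_ofReal, add_sub_cancel_right]
    rw [show t + a - x = t - (x - a) by abel]
    have : Complex.exp (-Complex.I * ((2 * Real.pi * inner ℝ (t + a) ξ : ℝ) : ℂ)) *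
        Complex.exp (Complex.I * ((2 * Real.pi * inner ℝ (t + a) b : ℝ) : ℂ)) =
        Complex.exp (((2 * Real.pi * inner ℝ a (b - ξ) : ℝ) : ℂ) * Complex.I) *
        Complex.exp (-Complex.I * ((2 * Real.pi * inner ℝ t (ξ - b) : ℝ) : ℂ)) := by
      rw [← Complex.exp_add, ← Complex.exp_add]
      congr 1
      simp only [inner_add_left, inner_sub_right]
      push_cast
      ring
    linear_combination (conj (φ (t - (x - a))) * ψ t) * this
  rw [h, norm_mul, Complex.norm_exp_ofReal_mul_I, one_mul]

theorem integrable_one_add_norm_prod {r : ℝ} (hr : (2 * n : ℝ) < r) :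
    Integrable fun z : V × V => (1 + ‖z‖) ^ (-r) := by
  have : (volume : Measure (V × V)).IsAddHaarMeasure :=
    Measure.prod.instIsAddHaarMeasure volume volume
  refine integrable_one_add_norm ?_
  rw [Module.finrank_prod]
  simpa [two_mul] using hr

theorem integrable_pow_mul_schwartzGabor (φ g : 𝓢(V, ℂ)) (N : ℕ) :
    Integrable fun z : V × V => (1 + ‖z‖) ^ N * ‖schwartzGabor φ g z.1 z.2‖ := by
  obtain ⟨C, hC, h⟩ := exists_one_add_norm_pow_mul_schwartzGabor_le φ g (N + (2 * n + 1))
  have hi := (integrable_one_add_norm_prod (n := n) (r := (2 * n + 1 : ℕ)) (by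
    push_cast; linarith)).const_mul C
  have hc := continuous_schwartzGabor φ g
  refine hi.mono' (by fun_prop) (Eventually.of_forall fun z => ?_)
  rw [Real.norm_of_nonneg (by positivity), Real.rpow_neg (by positivity), Real.rpow_natCast,
    ← div_eq_mul_inv, le_div_iff₀ (by positivity)]
  refine le_trans (le_of_eq ?_) (h z.1 z.2)
  rw [← Prod.norm_def, pow_add _ N]
  ring

end Decay

/-! ### Inversion formula and change of window -/

section Reproducing

variable {n : ℕ}

local notation "V" => EuclideanSpace ℝ (Fin n)

/-- The product of a Schwartz function with the conjugate of a translated window. -/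
def windowed (φ g : 𝓢(V, ℂ)) (x : V) : 𝓢(V, ℂ) :=
  SchwartzMap.smulLeftCLM ℂ (conjSchwartz (SchwartzMap.compSubConstCLM ℂ x φ)) g

theorem windowed_apply (φ g : 𝓢(V, ℂ)) (x t : V) :
    windowed φ g x t = conj (φ (t - x)) * g t := by
  rw [windowed, SchwartzMap.smulLeftCLM_apply_apply (SchwartzMap.hasTemperateGrowth _)]
  rfl

theorem schwartzGabor_eq_fourier (φ g : 𝓢(V, ℂ)) (x ξ : V) :
    schwartzGabor φ g x ξ = 𝓕 (windowed φ g x) ξ := by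
  rw [schwartzGabor_eq_integral, SchwartzMap.fourier_coe, Real.fourier_eq']
  congr 1
  ext t
  rw [windowed_apply, timeFreqShift_apply, map_mul, ← Complex.exp_conj, map_mul, Complex.conj_I,
    Complex.conj_ofReal, smul_eq_mul, ← mul_assoc]
  congr 3
  push_cast
  ring

/-- For fixed x the Gabor transform is the Fourier transform of the windowed function, so this is
Fourier inversion. Integrating over x next produces the factor ‖φ‖₂². -/
theorem integral_schwartzGabor_mul_exp (φ g : 𝓢(V, ℂ)) (x t : V) :
    ∫ ξ, schwartzGabor φ g x ξ * timeFreqShift x ξ φ t = conj (φ (t - x)) * φ (t - x) * g t := by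
  have h : 𝓕⁻ (𝓕 (windowed φ g x)) t = windowed φ g x t := by
    rw [FourierTransform.fourierInv_fourier_eq]
  rw [SchwartzMap.fourierInv_coe, Real.fourierInv_eq', windowed_apply] at h
  rw [mul_right_comm, ← h, ← integral_mul_const]
  congr 1
  ext ξ
  rw [schwartzGabor_eq_fourier, timeFreqShift_apply, smul_eq_mul, real_inner_comm t ξ]
  rw [mul_comm Complex.I]
  ring

theorem integral_norm_sq_pos {φ : 𝓢(V, ℂ)} (hφ : φ ≠ 0) : 0 < ∫ t, ‖φ t‖ ^ 2 := by
  have hc : Continuous fun t => ‖φ t‖ ^ 2 := by fun_prop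
  have hi : Integrable fun t => ‖φ t‖ ^ 2 := by
    have := (φ.memLp 2 volume).integrable_norm_pow (by norm_num)
    simpa using this
  obtain ⟨t, ht⟩ : ∃ t, φ t ≠ 0 := by
    by_contra! h
    exact hφ (SchwartzMap.ext h)
  exact integral_pos_of_integrable_nonneg_nonzero hc hi (fun t => by positivity) (x := t)
    (by simpa using ht)

theorem integral_prod_schwartzGabor (φ g : 𝓢(V, ℂ)) (t : V) :
    ∫ z : V × V, schwartzGabor φ g z.1 z.2 * timeFreqShift z.1 z.2 φ t =
      ((∫ y, ‖φ y‖ ^ 2 : ℝ) : ℂ) * g t := by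
  have hc : Continuous fun z : V × V => schwartzGabor φ g z.1 z.2 * timeFreqShift z.1 z.2 φ t :=
    (continuous_schwartzGabor φ g).mul
      (continuous_schwartz_apply (continuous_timeFreqShift φ) t)
  have hi : Integrable fun z : V × V =>
      schwartzGabor φ g z.1 z.2 * timeFreqShift z.1 z.2 φ t := by
    have h0 := (integrable_pow_mul_schwartzGabor φ g 0).mul_const (SchwartzMap.seminorm ℝ 0 0 φ)
    refine h0.mono' hc.aestronglyMeasurable (Eventually.of_forall fun z => ?_)
    rw [norm_mul, norm_timeFreqShift_apply, pow_zero, one_mul]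
    gcongr
    exact SchwartzMap.norm_le_seminorm ℝ φ _
  rw [Measure.volume_eq_prod, integral_prod _ hi]
  simp only [integral_schwartzGabor_mul_exp]
  rw [integral_mul_const]
  congr 1
  have h1 : ∀ x : V, conj (φ (t - x)) * φ (t - x) = ((‖φ (t - x)‖ ^ 2 : ℝ) : ℂ) := fun x => by
    rw [mul_comm, Complex.mul_conj, Complex.normSq_eq_norm_sq]
  simp only [h1]
  rw [integral_complex_ofReal, integral_sub_left_eq_self (fun y => ‖φ y‖ ^ 2) volume t]

theorem orderSeminorm_smul (m : ℕ) (c : ℂ) (f : 𝓢(V, ℂ)) :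
    orderSeminorm V m (c • f) ≤ ‖c‖ * orderSeminorm V m f := by
  refine orderSeminorm_le (by positivity) fun k hk l hl => ?_
  have h : SchwartzMap.seminorm ℂ k l (c • f) = ‖c‖ * SchwartzMap.seminorm ℂ k l f :=
    map_smul_eq_mul _ _ _
  refine h.le.trans ?_
  gcongr
  exact seminorm_le_orderSeminorm hk hl f

/-- The inversion formula for the Gabor transform, tested against a Schwartz function. -/
theorem integral_gaborTransform_mul_conj (φ g : 𝓢(V, ℂ)) (f : 𝓢'(V, ℂ)) :
    ((∫ y, ‖φ y‖ ^ 2 : ℝ) : ℂ) * f (conjSchwartz g) =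
      ∫ z : V × V, conj (schwartzGabor φ g z.1 z.2) * gaborTransform φ f z.1 z.2 := by
  have hc : Continuous fun z : V × V =>
      conj (schwartzGabor φ g z.1 z.2) • conjSchwartz (timeFreqShift z.1 z.2 φ) :=
    (Complex.continuous_conj.comp (continuous_schwartzGabor φ g)).smul
      (continuous_conjSchwartz_timeFreqShift φ)
  have hi : ∀ m, Integrable fun z : V × V => orderSeminorm V m
      (conj (schwartzGabor φ g z.1 z.2) • conjSchwartz (timeFreqShift z.1 z.2 φ)) := by
    intro m
    obtain ⟨N, C, hC, h⟩ := exists_orderSeminorm_timeFreqShift_le φ m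
    refine ((integrable_pow_mul_schwartzGabor φ g (N + N)).const_mul C).mono'
      ((continuous_orderSeminorm m).comp hc).aestronglyMeasurable
      (Eventually.of_forall fun z => ?_)
    rw [Real.norm_of_nonneg (apply_nonneg _ _)]
    refine (orderSeminorm_smul _ _ _).trans ?_
    rw [RCLike.norm_conj]
    have h1 : C * (1 + ‖z.1‖) ^ N * (1 + ‖z.2‖) ^ N ≤ C * (1 + ‖z‖) ^ N * (1 + ‖z‖) ^ N := by
      gcongr
      · exact norm_fst_le z
      · exact norm_snd_le z
    calc _ ≤ ‖schwartzGabor φ g z.1 z.2‖ * (C * (1 + ‖z‖) ^ N * (1 + ‖z‖) ^ N) := by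
          gcongr
          exact (h z.1 z.2).trans h1
      _ = _ := by rw [pow_add]; ring
  have key := temperedDistribution_integral (μ := volume) hc hi
    (g := ((∫ y, ‖φ y‖ ^ 2 : ℝ) : ℂ) • conjSchwartz g) (fun t => ?_) f
  · simp only [map_smul, smul_eq_mul] at key
    exact key
  · have h := congrArg conj (integral_prod_schwartzGabor φ g t)
    rw [← integral_conj, map_mul, Complex.conj_ofReal] at h
    simp only [map_mul] at h
    exact h.symm

/-- The inversion formula is tested against g = M_b T_a ψ, and covariance rewrites the modulus of
V_φ g. -/
theorem enorm_gaborTransform_le {φ : 𝓢(V, ℂ)} (hφ : φ ≠ 0) (ψ : 𝓢(V, ℂ)) (f : 𝓢'(V, ℂ))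
    (a b : V) :
    ‖gaborTransform ψ f a b‖ₑ ≤ ENNReal.ofReal (∫ y, ‖φ y‖ ^ 2)⁻¹ *
      ∫⁻ z : V × V, ‖gaborTransform φ f z.1 z.2‖ₑ * ‖schwartzGabor φ ψ (z.1 - a) (z.2 - b)‖ₑ := by
  have hpos := integral_norm_sq_pos hφ
  have h := integral_gaborTransform_mul_conj φ (timeFreqShift a b ψ) f
  have h1 : gaborTransform ψ f a b = (((∫ y, ‖φ y‖ ^ 2)⁻¹ : ℝ) : ℂ) *
      ∫ z : V × V, conj (schwartzGabor φ (timeFreqShift a b ψ) z.1 z.2) *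
        gaborTransform φ f z.1 z.2 := by
    rw [← h, ← mul_assoc, ← Complex.ofReal_mul, inv_mul_cancel₀ hpos.ne', Complex.ofReal_one,
      one_mul]
    rfl
  rw [h1, enorm_mul]
  gcongr
  · rw [← ofReal_norm, Complex.norm_real, Real.norm_of_nonneg (by positivity)]
  · refine (enorm_integral_le_lintegral_enorm _).trans (le_of_eq ?_)
    congr 1
    ext z
    rw [enorm_mul, mul_comm]
    congr 1
    rw [← ofReal_norm, ← ofReal_norm, RCLike.norm_conj,
      norm_schwartzGabor_timeFreqShift]

end Reproducing

/-! ### Passage to coordinates on phase space -/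

section Phase

theorem measurePreserving_append (m k : ℕ) :
    MeasurePreserving (fun q : (Fin m → ℝ) × (Fin k → ℝ) => Fin.append q.1 q.2) := by
  have h1 := (volume_measurePreserving_sumPiEquivProdPi_symm (fun _ : Fin m ⊕ Fin k => ℝ))
  have h2 := volume_measurePreserving_piCongrLeft (fun _ : Fin (m + k) => ℝ)
    (finSumFinEquiv (m := m) (n := k))
  suffices h3 : (fun q : (Fin m → ℝ) × (Fin k → ℝ) => Fin.append q.1 q.2) =
      ⇑(MeasurableEquiv.piCongrLeft (fun _ : Fin (m + k) => ℝ) finSumFinEquiv) ∘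
        ⇑(MeasurableEquiv.sumPiEquivProdPi fun _ : Fin m ⊕ Fin k => ℝ).symm by
    rw [h3]
    exact h2.comp h1
  funext q i
  refine Fin.addCases (fun j => ?_) (fun j => ?_) i
  · rw [Fin.append_left, Function.comp_apply, ← finSumFinEquiv_apply_left,
      MeasurableEquiv.piCongrLeft_apply_apply]
    rfl
  · rw [Fin.append_right, Function.comp_apply, ← finSumFinEquiv_apply_right,
      MeasurableEquiv.piCongrLeft_apply_apply]
    rfl

theorem measurable_append (m k : ℕ) :
    Measurable fun q : (Fin m → ℝ) × (Fin k → ℝ) => Fin.append q.1 q.2 :=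
  (measurePreserving_append m k).measurable

theorem lintegral_append (m k : ℕ) {F : (Fin (m + k) → ℝ) → ℝ≥0∞} (hF : Measurable F) :
    ∫⁻ z, F z = ∫⁻ x : Fin m → ℝ, ∫⁻ y : Fin k → ℝ, F (Fin.append x y) := by
  rw [← (measurePreserving_append m k).lintegral_comp hF, Measure.volume_eq_prod,
    lintegral_prod (fun q : (Fin m → ℝ) × (Fin k → ℝ) => F (Fin.append q.1 q.2))
      (hF.comp (measurable_append m k)).aemeasurable]

theorem lintegral_append_symm (m k : ℕ) {F : (Fin (m + k) → ℝ) → ℝ≥0∞} (hF : Measurable F) :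
    ∫⁻ z, F z = ∫⁻ y : Fin k → ℝ, ∫⁻ x : Fin m → ℝ, F (Fin.append x y) := by
  rw [← (measurePreserving_append m k).lintegral_comp hF, Measure.volume_eq_prod,
    lintegral_prod_symm (fun q : (Fin m → ℝ) × (Fin k → ℝ) => F (Fin.append q.1 q.2))
      (hF.comp (measurable_append m k)).aemeasurable]

variable {n : ℕ}

local notation "V" => EuclideanSpace ℝ (Fin n)

theorem lintegral_phase {F : (Fin (n + n) → ℝ) → ℝ≥0∞} (hF : Measurable F) :
    ∫⁻ z, F z = ∫⁻ x : V, ∫⁻ ξ : V, F (Fin.append x.ofLp ξ.ofLp) := by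
  rw [lintegral_append n n hF]
  have hm : ∀ x : Fin n → ℝ, Measurable fun y : Fin n → ℝ => F (Fin.append x y) := fun x =>
    hF.comp ((measurable_append n n).comp measurable_prodMk_left)
  have h1 : ∀ x : Fin n → ℝ, ∫⁻ y : Fin n → ℝ, F (Fin.append x y) =
      ∫⁻ ξ : V, F (Fin.append x ξ.ofLp) := fun x =>
    ((PiLp.volume_preserving_ofLp (Fin n)).lintegral_comp (hm x)).symm
  simp only [h1]
  refine ((PiLp.volume_preserving_ofLp (Fin n)).lintegral_comp
    (f := fun x : Fin n → ℝ => ∫⁻ ξ : V, F (Fin.append x ξ.ofLp)) ?_).symm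
  refine Measurable.lintegral_prod_right' (f := fun q : (Fin n → ℝ) × V =>
    F (Fin.append q.1 q.2.ofLp)) ?_
  exact hF.comp ((measurable_append n n).comp (measurable_fst.prodMk
    ((PiLp.volume_preserving_ofLp (Fin n)).measurable.comp measurable_snd)))

theorem gaborTransformPhase_append (φ : 𝓢(V, ℂ)) (f : 𝓢'(V, ℂ)) (x ξ : V) :
    gaborTransformPhase φ f (Fin.append x.ofLp ξ.ofLp) = gaborTransform φ f x ξ := by
  simp only [gaborTransformPhase, Fin.append_left, Fin.append_right, WithLp.toLp_ofLp]

theorem continuous_gaborTransformPhase (φ : 𝓢(V, ℂ)) (f : 𝓢'(V, ℂ)) :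
    Continuous (gaborTransformPhase φ f) := by
  refine (continuous_gaborTransform φ f).comp
    (f := fun z : Fin (n + n) → ℝ => ((WithLp.toLp 2 fun i => z (Fin.castAdd n i) : V),
      (WithLp.toLp 2 fun i => z (Fin.natAdd n i) : V))) ?_
  fun_prop

theorem norm_le_max_norm_halves (z : Fin (n + n) → ℝ) :
    ‖z‖ ≤ max ‖(WithLp.toLp 2 fun i => z (Fin.castAdd n i) : V)‖
      ‖(WithLp.toLp 2 fun i => z (Fin.natAdd n i) : V)‖ := by
  refine (pi_norm_le_iff_of_nonneg (by positivity)).2 fun i => ?_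
  refine Fin.addCases (fun j => ?_) (fun j => ?_) i
  · exact le_max_of_le_left
      (PiLp.norm_apply_le (WithLp.toLp 2 fun i => z (Fin.castAdd n i) : V) j)
  · exact le_max_of_le_right
      (PiLp.norm_apply_le (WithLp.toLp 2 fun i => z (Fin.natAdd n i) : V) j)

/-- The kernel `(1 + ‖z‖)^{-r}`. -/
def decayKernel {ι : Type*} [Fintype ι] (r : ℝ) (z : ι → ℝ) : ℝ≥0∞ :=
  ENNReal.ofReal ((1 + ‖z‖) ^ (-r))

theorem measurable_decayKernel {ι : Type*} [Fintype ι] (r : ℝ) :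
    Measurable (decayKernel r : (ι → ℝ) → ℝ≥0∞) := by
  unfold decayKernel; fun_prop

theorem exists_enorm_schwartzGabor_le (φ g : 𝓢(V, ℂ)) (r : ℝ) :
    ∃ C : ℝ≥0∞, C ≠ ∞ ∧ ∀ z : Fin (n + n) → ℝ,
      ‖schwartzGabor φ g (WithLp.toLp 2 fun i => z (Fin.castAdd n i))
        (WithLp.toLp 2 fun i => z (Fin.natAdd n i))‖ₑ ≤ C * decayKernel r z := by
  obtain ⟨N, hN⟩ := exists_nat_ge r
  obtain ⟨C, hC, h⟩ := exists_one_add_norm_pow_mul_schwartzGabor_le φ g N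
  refine ⟨ENNReal.ofReal C, ENNReal.ofReal_ne_top, fun z => ?_⟩
  rw [decayKernel, ← ENNReal.ofReal_mul hC, ← ofReal_norm]
  refine ENNReal.ofReal_le_ofReal ?_
  have h1 : (1 + ‖z‖) ^ (-(N : ℝ)) ≤ (1 + ‖z‖) ^ (-r) :=
    Real.rpow_le_rpow_of_exponent_le (by linarith [norm_nonneg z]) (by linarith)
  refine le_trans ?_ (mul_le_mul_of_nonneg_left h1 hC)
  rw [Real.rpow_neg (by positivity), Real.rpow_natCast, ← div_eq_mul_inv,
    le_div_iff₀ (by positivity), mul_comm]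
  refine le_trans ?_ (h (WithLp.toLp 2 fun i => z (Fin.castAdd n i))
    (WithLp.toLp 2 fun i => z (Fin.natAdd n i)))
  gcongr
  exact norm_le_max_norm_halves z

/-- Here V_φ ψ is replaced by a power of arbitrary order. The constant does not depend on f, and the
kernel uses the sup norm, which any permutation of the coordinates preserves. -/
theorem exists_enorm_gaborTransformPhase_le {φ : 𝓢(V, ℂ)} (hφ : φ ≠ 0) (ψ : 𝓢(V, ℂ)) (r : ℝ) :
    ∃ C : ℝ≥0∞, C ≠ ∞ ∧ ∀ (f : 𝓢'(V, ℂ)) (w : Fin (n + n) → ℝ),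
      ‖gaborTransformPhase ψ f w‖ₑ ≤
        C * ∫⁻ z, ‖gaborTransformPhase φ f z‖ₑ * decayKernel r (z - w) := by
  obtain ⟨C, hC, h⟩ := exists_enorm_schwartzGabor_le φ ψ r
  refine ⟨ENNReal.ofReal (∫ y, ‖φ y‖ ^ 2)⁻¹ * C, ENNReal.mul_ne_top ENNReal.ofReal_ne_top hC,
    fun f w => ?_⟩
  have hm : Measurable fun z => ‖gaborTransformPhase φ f z‖ₑ * decayKernel r (z - w) :=
    (continuous_gaborTransformPhase φ f).measurable.enorm.mul
      ((measurable_decayKernel r).comp (measurable_id.sub_const w))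
  have hc := continuous_gaborTransform φ f
  rw [lintegral_phase hm, mul_assoc]
  refine (enorm_gaborTransform_le hφ ψ f _ _).trans ?_
  gcongr
  have hm2 : Measurable fun z : V × V => ‖gaborTransform φ f z.1 z.2‖ₑ *
      decayKernel r (Fin.append z.1.ofLp z.2.ofLp - w) := by
    refine hc.measurable.enorm.mul ((measurable_decayKernel r).comp (Measurable.sub_const ?_ w))
    exact (measurable_append n n).comp (by fun_prop :
      Measurable fun z : V × V => (z.1.ofLp, z.2.ofLp))
  simp only [gaborTransformPhase_append]
  rw [← lintegral_prod (μ := (volume : Measure V)) (ν := (volume : Measure V))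
    (fun z : V × V => ‖gaborTransform φ f z.1 z.2‖ₑ *
      decayKernel r (Fin.append z.1.ofLp z.2.ofLp - w)) hm2.aemeasurable,
    ← lintegral_const_mul _ hm2, ← Measure.volume_eq_prod]
  refine lintegral_mono fun z => ?_
  rw [mul_left_comm]
  gcongr
  refine le_trans (le_of_eq ?_) (h _)
  congr 2
  · ext i; simp only [PiLp.sub_apply, Pi.sub_apply, Fin.append_left]
  · ext i; simp only [PiLp.sub_apply, Pi.sub_apply, Fin.append_right]

end Phase

/-! ### Iterated norms: splitting and constant exponents -/

section Iterated

theorem snoc_append {α : Type*} {m k : ℕ} (x : Fin m → α) (y : Fin k → α) (t : α) :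
    (Fin.snoc (Fin.append x y) t : Fin (m + k + 1) → α) =
      Fin.append x (Fin.snoc y t : Fin (k + 1) → α) :=
  (Fin.append_snoc x y t).symm

theorem init_append {α : Type*} {m k : ℕ} (p : Fin m → α) (q : Fin (k + 1) → α) :
    (Fin.init (show Fin (m + k + 1) → α from Fin.append (n := k + 1) p q) : Fin (m + k) → α) =
      Fin.append p (Fin.init q) := by
  have h := snoc_append p (Fin.init q) (q (Fin.last k))
  rw [Fin.snoc_init_self] at h
  rw [← h, Fin.init_snoc]

theorem iteratedLpNorm_append (m k : ℕ) (p : Fin m → ℝ≥0∞) (q : Fin k → ℝ≥0∞)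
    (F : (Fin (m + k) → ℝ) → ℝ≥0∞) :
    iteratedLpNorm (m + k) (Fin.append p q) F =
      iteratedLpNorm k q fun y => iteratedLpNorm m p fun x => F (Fin.append x y) := by
  induction k with
  | zero =>
    have h1 : ∀ {α : Type} (u : Fin m → α) (v : Fin 0 → α), Fin.append u v = u := fun u v =>
      funext fun i => Fin.append_left u v i
    simp only [iteratedLpNorm, h1]
    rfl
  | succ k ih =>
    change eLpNorm (fun t : ℝ => iteratedLpNorm (m + k)
      (Fin.init (show Fin (m + k + 1) → ℝ≥0∞ from Fin.append (n := k + 1) p q)) fun y =>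
        F (Fin.snoc y t : Fin (m + k + 1) → ℝ)) (Fin.append p q (Fin.natAdd m (Fin.last k))) volume =
      eLpNorm (fun t : ℝ => iteratedLpNorm k (Fin.init q) fun y => iteratedLpNorm m p fun x =>
        F (Fin.append x (Fin.snoc y t : Fin (k + 1) → ℝ))) (q (Fin.last k)) volume
    rw [Fin.append_right, init_append]
    simp only [ih, snoc_append]

theorem lintegral_snoc {n : ℕ} {F : (Fin (n + 1) → ℝ) → ℝ≥0∞} (hF : Measurable F) :
    ∫⁻ z, F z = ∫⁻ t : ℝ, ∫⁻ y : Fin n → ℝ, F (Fin.snoc y t) := by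
  rw [lintegral_append_symm n 1 hF]
  have h := (volume_preserving_funUnique (Fin 1) ℝ).symm.lintegral_comp_emb
    (MeasurableEquiv.measurableEmbedding _)
    (fun y : Fin 1 → ℝ => ∫⁻ x : Fin n → ℝ, F (Fin.append x y))
  refine h.symm.trans ?_
  congr 1
  ext t
  congr 1
  ext y
  rw [Fin.append_right_eq_snoc]
  rfl

/-- Tonelli, one variable at a time: the inner root cancels against the next power. For n = 0 the
volume is a Dirac mass. -/
theorem iteratedLpNorm_const (n : ℕ) {p : ℝ≥0∞} (h0 : p ≠ 0) (hp : p ≠ ∞)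
    {F : (Fin n → ℝ) → ℝ≥0∞} (hF : Measurable F) :
    iteratedLpNorm n (fun _ => p) F = (∫⁻ z, F z ^ p.toReal) ^ (1 / p.toReal) := by
  have hr : p.toReal ≠ 0 := (ENNReal.toReal_pos h0 hp).ne'
  induction n with
  | zero =>
    rw [Measure.volume_pi_eq_dirac (Fin.elim0), lintegral_dirac' _ (hF.pow_const _),
      ← ENNReal.rpow_mul, mul_one_div_cancel hr, ENNReal.rpow_one]
    rfl
  | succ n ih =>
    have hs : ∀ t : ℝ, Measurable fun y : Fin n → ℝ => F (Fin.snoc y t) := fun t => by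
      refine hF.comp (measurable_pi_iff.2 fun i => ?_)
      refine Fin.lastCases ?_ (fun j => ?_) i
      · simp only [Fin.snoc_last]; exact measurable_const
      · simp only [Fin.snoc_castSucc]; exact measurable_pi_apply j
    change eLpNorm (fun t : ℝ => iteratedLpNorm n (fun _ => p) fun y =>
      F (Fin.snoc y t : Fin (n + 1) → ℝ)) p volume = _
    simp only [fun t => ih (hs t)]
    rw [eLpNorm_eq_lintegral_rpow_enorm_toReal h0 hp, lintegral_snoc (hF.pow_const _)]
    congr 2
    ext t
    rw [enorm_eq_self, ← ENNReal.rpow_mul, one_div_mul_cancel hr, ENNReal.rpow_one]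

theorem iteratedLpNorm_top_le (n : ℕ) {F : (Fin n → ℝ) → ℝ≥0∞} {C : ℝ≥0∞} (hF : ∀ z, F z ≤ C) :
    iteratedLpNorm n (fun _ => ∞) F ≤ C := by
  induction n with
  | zero => exact hF _
  | succ n ih =>
    change eLpNorm (fun t : ℝ => iteratedLpNorm n (fun _ => ∞) fun y =>
      F (Fin.snoc y t : Fin (n + 1) → ℝ)) ∞ volume ≤ C
    rw [eLpNorm_exponent_top]
    refine essSup_le_of_ae_le _ (Eventually.of_forall fun t => ?_)
    exact ih fun y => hF _

theorem append_const {α : Type*} (m k : ℕ) (a : α) :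
    Fin.append (fun _ : Fin m => a) (fun _ : Fin k => a) = fun _ => a := by
  funext i
  refine Fin.addCases (fun j => ?_) (fun j => ?_) i
  · rw [Fin.append_left]
  · rw [Fin.append_right]

end Iterated

/-! ### Membership criteria in terms of integrals -/

section Membership

variable {n : ℕ}

local notation "V" => EuclideanSpace ℝ (Fin n)

theorem continuous_polyWeight {m : ℕ} (s : ℝ) : Continuous (polyWeight s : (Fin m → ℝ) → ℝ) := by
  unfold polyWeight
  refine Continuous.rpow_const (by fun_prop) fun z => Or.inl ?_
  positivity

theorem mem_modulationSpace_iff (φ : 𝓢(V, ℂ)) (s : ℝ) (f : 𝓢'(V, ℂ)) :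
    f ∈ modulationSpace φ 2 2 (polyWeight s) ↔
      ∫⁻ z, (‖gaborTransformPhase φ f z‖ₑ * ENNReal.ofReal (polyWeight s z)) ^ 2 < ∞ := by
  have hm : Measurable fun z => ‖gaborTransformPhase φ f z * (polyWeight s z : ℂ)‖ₑ :=
    ((continuous_gaborTransformPhase φ f).mul
      (Complex.continuous_ofReal.comp (continuous_polyWeight s))).measurable.enorm
  have hw : ∀ z : Fin (n + n) → ℝ, ‖(polyWeight s z : ℂ)‖ₑ = ENNReal.ofReal (polyWeight s z) := by
    intro z
    rw [← ofReal_norm, Complex.norm_real, Real.norm_of_nonneg]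
    unfold polyWeight
    positivity
  change iteratedLpNorm (n + n) _ _ < ∞ ↔ _
  rw [append_const, iteratedLpNorm_const _ (by norm_num) (by norm_num) hm,
    ENNReal.rpow_lt_top_iff_of_pos (by norm_num)]
  simp only [enorm_mul, hw, ENNReal.toReal_ofNat, ENNReal.rpow_ofNat]

/-- The squared inner norm of the permuted Gabor transform. -/
def innerSq {m : ℕ} (ψ : 𝓢(V, ℂ)) (f : 𝓢'(V, ℂ)) (c : Fin (n + n) → Fin (m + m))
    (y : Fin m → ℝ) : ℝ≥0∞ :=
  ∫⁻ x : Fin m → ℝ, ‖gaborTransformPhase ψ f fun i => Fin.append x y (c i)‖ₑ ^ 2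

theorem continuous_gaborTransformPhase_perm {k : ℕ} (ψ : 𝓢(V, ℂ)) (f : 𝓢'(V, ℂ))
    (c : Fin (n + n) → Fin k) :
    Continuous fun z : Fin k → ℝ => gaborTransformPhase ψ f fun i => z (c i) :=
  (continuous_gaborTransformPhase ψ f).comp (by fun_prop)

theorem mixedLpNorm_eq (ψ : 𝓢(V, ℂ)) (f : 𝓢'(V, ℂ)) (c : Equiv.Perm (Fin (n + n))) (p : ℝ≥0∞) :
    mixedLpNorm (Fin.append (fun _ : Fin n => (2 : ℝ≥0∞)) (fun _ : Fin n => p)) (fun _ => 1)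
      (fun x => gaborTransformPhase ψ f fun i => x (c i)) =
    iteratedLpNorm n (fun _ => p) fun y => innerSq ψ f c y ^ (1 / 2 : ℝ) := by
  have hm : ∀ y : Fin n → ℝ, Measurable fun x : Fin n → ℝ =>
      ‖gaborTransformPhase ψ f fun i => Fin.append x y (c i)‖ₑ := fun y =>
    ((continuous_gaborTransformPhase_perm ψ f c).measurable.comp
      ((measurable_append n n).comp measurable_prodMk_right)).enorm
  simp only [mixedLpNorm, Complex.ofReal_one, mul_one]
  rw [iteratedLpNorm_append]
  congr 1
  ext y
  rw [iteratedLpNorm_const _ (by norm_num) (by norm_num) (hm y)]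
  simp [innerSq]

theorem measurable_innerSq (ψ : 𝓢(V, ℂ)) (f : 𝓢'(V, ℂ)) (c : Equiv.Perm (Fin (n + n))) :
    Measurable (innerSq ψ f c) := by
  refine Measurable.lintegral_prod_left' (f := fun q : (Fin n → ℝ) × (Fin n → ℝ) =>
    ‖gaborTransformPhase ψ f fun i => Fin.append q.1 q.2 (c i)‖ₑ ^ 2) ?_
  exact (((continuous_gaborTransformPhase_perm ψ f c).measurable.comp
      (measurable_append n n)).enorm).pow_const 2

theorem mem_mixedModulationSpace_of_lintegral (ψ : 𝓢(V, ℂ)) (f : 𝓢'(V, ℂ))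
    (c : Equiv.Perm (Fin (n + n))) {p : ℝ≥0∞} (h0 : p ≠ 0) (hp : p ≠ ∞)
    (h : ∫⁻ y, innerSq ψ f c y ^ (p.toReal / 2) < ∞) :
    f ∈ mixedModulationSpace ψ c
      (Fin.append (fun _ : Fin n => (2 : ℝ≥0∞)) (fun _ : Fin n => p)) (fun _ => 1) := by
  change mixedLpNorm _ _ _ < ∞
  have hr := ENNReal.toReal_pos h0 hp
  rw [mixedLpNorm_eq, iteratedLpNorm_const _ h0 hp ((measurable_innerSq ψ f c).pow_const _),
    ENNReal.rpow_lt_top_iff_of_pos (by positivity)]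
  refine lt_of_eq_of_lt ?_ h
  congr 1
  ext y
  rw [← ENNReal.rpow_mul]
  congr 1
  ring

theorem mem_mixedModulationSpace_top (ψ : 𝓢(V, ℂ)) (f : 𝓢'(V, ℂ))
    (c : Equiv.Perm (Fin (n + n))) {C : ℝ≥0∞} (hC : C ≠ ∞) (h : ∀ y, innerSq ψ f c y ≤ C) :
    f ∈ mixedModulationSpace ψ c
      (Fin.append (fun _ : Fin n => (2 : ℝ≥0∞)) (fun _ : Fin n => ∞)) (fun _ => 1) := by
  change mixedLpNorm _ _ _ < ∞
  rw [mixedLpNorm_eq]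
  refine (iteratedLpNorm_top_le n (C := C ^ (1 / 2 : ℝ)) fun y => ?_).trans_lt
    (ENNReal.rpow_lt_top_of_nonneg (by norm_num) hC)
  exact ENNReal.rpow_le_rpow (h y) (by norm_num)

end Membership

/-! ### Decaying kernels and weighted slices -/

section Kernel

variable {ι : Type*} [Fintype ι]

/-- Jensen's inequality for the weight `k`. -/
theorem lintegral_mul_rpow_le {α : Type*} [MeasurableSpace α] {μ : Measure α} {q : ℝ} (hq : 1 ≤ q)
    {f k : α → ℝ≥0∞} (hf : Measurable f) (hk : Measurable k) :
    (∫⁻ a, f a * k a ∂μ) ^ q ≤ (∫⁻ a, k a ∂μ) ^ (q - 1) * ∫⁻ a, f a ^ q * k a ∂μ := by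
  rcases hq.eq_or_lt with rfl | hq1
  · simp
  have hpq := Real.HolderConjugate.conjExponent hq1
  have h := ENNReal.lintegral_mul_le_Lp_mul_Lq (μ.withDensity k) hpq hf.aemeasurable
    (measurable_const (a := (1 : ℝ≥0∞))).aemeasurable
  have e1 : ∀ g : α → ℝ≥0∞, Measurable g → ∫⁻ a, g a ∂(μ.withDensity k) = ∫⁻ a, g a * k a ∂μ := by
    intro g hg
    rw [lintegral_withDensity_eq_lintegral_mul _ hk hg]
    simp [mul_comm]
  simp only [Pi.mul_apply, mul_one, ENNReal.one_rpow] at h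
  rw [e1 _ hf, e1 _ (hf.pow_const q), e1 _ measurable_const] at h
  simp only [one_mul] at h
  have hq0 : 0 < q := by linarith
  calc (∫⁻ a, f a * k a ∂μ) ^ q
      ≤ ((∫⁻ a, f a ^ q * k a ∂μ) ^ (1 / q) * (∫⁻ a, k a ∂μ) ^ (1 / q.conjExponent)) ^ q :=
        ENNReal.rpow_le_rpow h hq0.le
    _ = (∫⁻ a, k a ∂μ) ^ (q - 1) * ∫⁻ a, f a ^ q * k a ∂μ := by
        rw [ENNReal.mul_rpow_of_nonneg _ _ hq0.le, ← ENNReal.rpow_mul, ← ENNReal.rpow_mul,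
          one_div_mul_cancel hq0.ne', ENNReal.rpow_one, mul_comm]
        congr 2
        rw [Real.conjExponent]
        field_simp

theorem lintegral_mul_sq_le {α : Type*} [MeasurableSpace α] {μ : Measure α}
    {f k : α → ℝ≥0∞} (hf : Measurable f) (hk : Measurable k) :
    (∫⁻ a, f a * k a ∂μ) ^ 2 ≤ (∫⁻ a, k a ∂μ) * ∫⁻ a, f a ^ 2 * k a ∂μ := by
  have h := lintegral_mul_rpow_le (μ := μ) (q := 2) (by norm_num) hf hk
  simpa [show (2 : ℝ) - 1 = 1 by norm_num] using h

theorem decayKernel_add (r r' : ℝ) (z : ι → ℝ) :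
    decayKernel (r + r') z = decayKernel r z * decayKernel r' z := by
  rw [decayKernel, decayKernel, decayKernel, ← ENNReal.ofReal_mul (by positivity),
    ← Real.rpow_add (by positivity)]
  congr 2
  ring

theorem decayKernel_rpow (r q : ℝ) (hq : 0 ≤ q) (z : ι → ℝ) :
    decayKernel r z ^ q = decayKernel (r * q) z := by
  rw [decayKernel, decayKernel, ENNReal.ofReal_rpow_of_nonneg (by positivity) hq,
    ← Real.rpow_mul (by positivity), neg_mul]

theorem decayKernel_le_one {r : ℝ} (hr : 0 ≤ r) (z : ι → ℝ) : decayKernel r z ≤ 1 := by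
  rw [decayKernel, ENNReal.ofReal_le_one]
  exact Real.rpow_le_one_of_one_le_of_nonpos (by linarith [norm_nonneg z]) (by linarith)

theorem decayKernel_anti {ι' : Type*} [Fintype ι'] {r : ℝ} (hr : 0 ≤ r) {z : ι → ℝ} {y : ι' → ℝ}
    (h : ‖y‖ ≤ ‖z‖) : decayKernel r z ≤ decayKernel r y := by
  refine ENNReal.ofReal_le_ofReal ?_
  exact Real.rpow_le_rpow_of_nonpos (by positivity) (by linarith) (by linarith)

theorem lintegral_decayKernel_lt_top {r : ℝ} (hr : (Fintype.card ι : ℝ) < r) :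
    ∫⁻ z : ι → ℝ, decayKernel r z < ∞ :=
  finite_integral_one_add_norm (by simpa using hr)

theorem lintegral_decayKernel_sub (r : ℝ) (w : ι → ℝ) :
    ∫⁻ z : ι → ℝ, decayKernel r (z - w) = ∫⁻ z : ι → ℝ, decayKernel r z :=
  lintegral_sub_right_eq_self _ w

theorem lintegral_decayKernel_sub_left (r : ℝ) (w : ι → ℝ) :
    ∫⁻ z : ι → ℝ, decayKernel r (w - z) = ∫⁻ z : ι → ℝ, decayKernel r z :=
  lintegral_sub_left_eq_self _ w

/-- Peetre's inequality. -/
theorem decayKernel_peetre {s : ℝ} (hs : 0 ≤ s) (z w : ι → ℝ) :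
    decayKernel s (z - w) ≤ decayKernel s w * decayKernel (-s) z := by
  rw [decayKernel, decayKernel, decayKernel, ← ENNReal.ofReal_mul (by positivity)]
  refine ENNReal.ofReal_le_ofReal ?_
  rw [neg_neg, Real.rpow_neg (by positivity), Real.rpow_neg (by positivity), inv_mul_eq_div,
    le_div_iff₀ (by positivity), inv_mul_le_iff₀ (by positivity),
    ← Real.mul_rpow (by positivity) (by positivity)]
  refine Real.rpow_le_rpow (by positivity) ?_ hs
  have : ‖w‖ ≤ ‖z‖ + ‖z - w‖ := by simpa using norm_sub_le z (z - w)
  nlinarith [norm_nonneg z, norm_nonneg (z - w)]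

theorem norm_le_norm_append_left {m k : ℕ} (x : Fin m → ℝ) (y : Fin k → ℝ) :
    ‖x‖ ≤ ‖Fin.append x y‖ := by
  refine (pi_norm_le_iff_of_nonneg (norm_nonneg _)).2 fun i => ?_
  simpa using norm_le_pi_norm (Fin.append x y) (Fin.castAdd k i)

theorem norm_le_norm_append_right {m k : ℕ} (x : Fin m → ℝ) (y : Fin k → ℝ) :
    ‖y‖ ≤ ‖Fin.append x y‖ := by
  refine (pi_norm_le_iff_of_nonneg (norm_nonneg _)).2 fun i => ?_
  simpa only [Fin.append_right] using norm_le_pi_norm (Fin.append x y) (Fin.natAdd m i)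

theorem lintegral_decayKernel_sub_append_le {m k : ℕ} {r : ℝ} (hr : 0 ≤ r) (z : Fin (m + k) → ℝ)
    (y : Fin k → ℝ) :
    ∫⁻ x : Fin m → ℝ, decayKernel r (z - Fin.append x y) ≤ ∫⁻ x : Fin m → ℝ, decayKernel r x := by
  rw [← lintegral_decayKernel_sub_left r fun i => z (Fin.castAdd k i)]
  refine lintegral_mono fun x => decayKernel_anti hr ?_
  refine (pi_norm_le_iff_of_nonneg (norm_nonneg _)).2 fun i => ?_
  simpa using norm_le_pi_norm (z - Fin.append x y) (Fin.castAdd k i)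

/-- A function dominated by the convolution of a weighted `L²` function with a decaying kernel
has slices whose weighted `L²` norms are both bounded and square integrable. -/
theorem exists_slice_bound {m k : ℕ} {s : ℝ} (hs : 0 ≤ s) {r : ℝ} (hr : (m + k : ℝ) + s < r)
    {A F : (Fin (m + k) → ℝ) → ℝ≥0∞} (hF : Measurable F) {C : ℝ≥0∞} (hC : C ≠ ∞)
    (hA : ∀ w, A w ≤ C * ∫⁻ z, F z * decayKernel r (z - w))
    (hFint : ∫⁻ z, (F z * decayKernel (-s) z) ^ 2 < ∞) :
    ∃ (g : (Fin k → ℝ) → ℝ≥0∞) (D : ℝ≥0∞), D ≠ ∞ ∧ (∀ y, g y ≤ D) ∧ ∫⁻ y, g y < ∞ ∧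
      ∀ y, ∫⁻ x, A (Fin.append x y) ^ 2 ≤ decayKernel (2 * s) y * g y := by
  set H : (Fin (m + k) → ℝ) → ℝ≥0∞ := fun z => (F z * decayKernel (-s) z) ^ 2 with hH
  have hFm : Measurable fun z => F z * decayKernel (-s) z := hF.mul (measurable_decayKernel _)
  have hHm : Measurable H := hFm.pow_const 2
  set I := ∫⁻ z : Fin (m + k) → ℝ, decayKernel (r - s) z with hI
  have hItop : I < ∞ := lintegral_decayKernel_lt_top (by simp; linarith)
  have hrs : 0 ≤ r - s := by
    have : (0 : ℝ) ≤ m + k := by positivity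
    linarith
  set I' := ∫⁻ x : Fin m → ℝ, decayKernel (r - s) x with hI'
  have hI'top : I' < ∞ := lintegral_decayKernel_lt_top (by
    have : (0 : ℝ) ≤ k := by positivity
    simp; linarith)
  have hkm : ∀ w : Fin (m + k) → ℝ, Measurable fun z => decayKernel (r - s) (z - w) := fun w =>
    (measurable_decayKernel _).comp (measurable_id.sub_const w)
  set B : (Fin (m + k) → ℝ) → ℝ≥0∞ := fun w => ∫⁻ z, H z * decayKernel (r - s) (z - w) with hB
  have hjoint : Measurable fun q : (Fin (m + k) → ℝ) × (Fin (m + k) → ℝ) =>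
      H q.1 * decayKernel (r - s) (q.1 - q.2) :=
    (hHm.comp measurable_fst).mul ((measurable_decayKernel _).comp
      (measurable_fst.sub measurable_snd))
  have hBm : Measurable B := Measurable.lintegral_prod_left' hjoint
  -- Split the kernel as order s times order r - s. Peetre turns the first factor into decay in w
  -- and a weight on F; Cauchy–Schwarz for the second gives B, the convolution of the integrable H
  -- with a kernel of order r - s > m + k.
  have hpt : ∀ w, A w ^ 2 ≤ decayKernel (2 * s) w * (C ^ 2 * I * B w) := by
    intro w
    have h1 : A w ≤ decayKernel s w *
        (C * ∫⁻ z, (F z * decayKernel (-s) z) * decayKernel (r - s) (z - w)) := by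
      refine (hA w).trans ?_
      rw [mul_left_comm]
      gcongr
      have hm : Measurable fun z => F z * decayKernel (-s) z * decayKernel (r - s) (z - w) :=
        hFm.mul (hkm w)
      rw [← lintegral_const_mul _ hm]
      refine lintegral_mono fun z => ?_
      have h2 : decayKernel r (z - w) = decayKernel s (z - w) * decayKernel (r - s) (z - w) := by
        rw [← decayKernel_add]; congr 1; ring
      rw [h2]
      calc F z * (decayKernel s (z - w) * decayKernel (r - s) (z - w))
          ≤ F z * ((decayKernel s w * decayKernel (-s) z) * decayKernel (r - s) (z - w)) := by
            gcongr; exact decayKernel_peetre hs z w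
        _ = _ := by ring
    calc A w ^ 2 ≤ (decayKernel s w *
        (C * ∫⁻ z, (F z * decayKernel (-s) z) * decayKernel (r - s) (z - w))) ^ 2 := by gcongr
      _ = decayKernel (2 * s) w * (C ^ 2 *
        (∫⁻ z, (F z * decayKernel (-s) z) * decayKernel (r - s) (z - w)) ^ 2) := by
          rw [two_mul, decayKernel_add]; ring
      _ ≤ decayKernel (2 * s) w * (C ^ 2 * (I * B w)) := by
          gcongr
          refine (lintegral_mul_sq_le hFm (hkm w)).trans_eq ?_
          rw [lintegral_decayKernel_sub]
      _ = _ := by ring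
  -- The function g is a partial integral of B. It is bounded because a slice of the kernel has
  -- integral at most I' whatever its centre, and integrable because B is.
  refine ⟨fun y => C ^ 2 * I * ∫⁻ x : Fin m → ℝ, B (Fin.append x y),
    C ^ 2 * I * (I' * ∫⁻ z, H z), ?_, fun y => ?_, ?_, fun y => ?_⟩
  · exact ENNReal.mul_ne_top (ENNReal.mul_ne_top (ENNReal.pow_ne_top hC) hItop.ne)
      (ENNReal.mul_ne_top hI'top.ne hFint.ne)
  · refine mul_le_mul_right ?_ _
    rw [hB]
    simp only
    rw [lintegral_lintegral_swap]
    · rw [← lintegral_const_mul _ hHm]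
      refine lintegral_mono fun z => ?_
      simp only
      have hm : Measurable fun x : Fin m → ℝ => decayKernel (r - s) (z - Fin.append x y) :=
        (measurable_decayKernel _).comp (Measurable.const_sub
          ((measurable_append m k).comp measurable_prodMk_right) z)
      rw [lintegral_const_mul _ hm, mul_comm]
      gcongr
      exact lintegral_decayKernel_sub_append_le hrs z y
    · exact (hjoint.comp (measurable_snd.prodMk ((measurable_append m k).comp
        (measurable_fst.prodMk measurable_const)))).aemeasurable
  · rw [lintegral_const_mul' _ _ (ENNReal.mul_ne_top (ENNReal.pow_ne_top hC) hItop.ne),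
      ← lintegral_append_symm m k hBm]
    refine ENNReal.mul_lt_top (ENNReal.mul_lt_top (ENNReal.pow_lt_top hC.lt_top) hItop) ?_
    rw [hB, lintegral_lintegral_swap (f := fun w z => H z * decayKernel (r - s) (z - w))
      (hjoint.comp measurable_swap).aemeasurable]
    have : ∀ z : Fin (m + k) → ℝ, ∫⁻ w, H z * decayKernel (r - s) (z - w) = H z * I := by
      intro z
      have hm : Measurable fun w : Fin (m + k) → ℝ => decayKernel (r - s) (z - w) :=
        (measurable_decayKernel _).comp (measurable_id.const_sub z)
      rw [lintegral_const_mul _ hm, lintegral_decayKernel_sub_left]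
    simp only [this]
    rw [lintegral_mul_const _ hHm]
    exact ENNReal.mul_lt_top hFint hItop
  · have hm : Measurable fun x : Fin m → ℝ => B (Fin.append x y) :=
      hBm.comp ((measurable_append m k).comp measurable_prodMk_right)
    simp only
    rw [← lintegral_const_mul _ hm, ← lintegral_const_mul _ (hm.const_mul _)]
    refine lintegral_mono fun x => (hpt _).trans ?_
    gcongr
    exact decayKernel_anti (by positivity) (norm_le_norm_append_right x y)

/-- For q ≥ 1, g^q ≤ D^{q-1} g. For q < 1, the decay factor to the power q is written as a^{1-q},
and a^{1-q} g^q ≤ a + g. Here a is a kernel of order 2sq/(1-q), and this exceeds k exactly when k <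
q(2s + k). -/
theorem lintegral_rpow_lt_top {k : ℕ} {s q : ℝ} (hs : 0 ≤ s) (hq : 0 < q)
    (hqs : (k : ℝ) < q * (2 * s + k)) {G g : (Fin k → ℝ) → ℝ≥0∞} {D : ℝ≥0∞} (hD : D ≠ ∞)
    (hgD : ∀ y, g y ≤ D) (hg : ∫⁻ y, g y < ∞) (hG : ∀ y, G y ≤ decayKernel (2 * s) y * g y) :
    ∫⁻ y, G y ^ q < ∞ := by
  rcases le_or_gt 1 q with h1 | h1
  · have h : ∀ y, G y ^ q ≤ D ^ (q - 1) * g y := by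
      intro y
      have h2 : G y ≤ g y := (hG y).trans (mul_le_of_le_one_left' (decayKernel_le_one
        (by positivity) y))
      calc G y ^ q ≤ g y ^ q := ENNReal.rpow_le_rpow h2 hq.le
        _ = g y ^ ((q - 1) + 1) := by rw [sub_add_cancel]
        _ = g y ^ (q - 1) * g y := by
          rw [ENNReal.rpow_add_of_nonneg _ _ (by linarith) zero_le_one, ENNReal.rpow_one]
        _ ≤ _ := by gcongr; exact hgD y
    refine (lintegral_mono h).trans_lt ?_
    have hD' : D ^ (q - 1) < ∞ := ENNReal.rpow_lt_top_of_nonneg (by linarith) hD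
    rw [lintegral_const_mul' _ _ hD'.ne]
    exact ENNReal.mul_lt_top hD' hg
  · have hq1 : 0 < 1 - q := by linarith
    have h : ∀ y, G y ^ q ≤ decayKernel (2 * s * (q / (1 - q))) y + g y := by
      intro y
      set a := decayKernel (2 * s * (q / (1 - q))) y with ha
      have ha2 : decayKernel (2 * s) y ^ q = a ^ (1 - q) := by
        rw [ha, decayKernel_rpow _ _ hq.le, decayKernel_rpow _ _ hq1.le]
        congr 1
        field_simp
      calc G y ^ q ≤ (decayKernel (2 * s) y * g y) ^ q := ENNReal.rpow_le_rpow (hG y) hq.le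
        _ = a ^ (1 - q) * g y ^ q := by rw [ENNReal.mul_rpow_of_nonneg _ _ hq.le, ha2]
        _ ≤ (max a (g y)) ^ (1 - q) * (max a (g y)) ^ q := by
          gcongr
          · exact le_max_left _ _
          · exact le_max_right _ _
        _ = max a (g y) := by
          rw [← ENNReal.rpow_add_of_nonneg _ _ hq1.le hq.le, sub_add_cancel, ENNReal.rpow_one]
        _ ≤ a + g y := max_le (le_add_right le_rfl) (le_add_left le_rfl)
    refine (lintegral_mono h).trans_lt ?_
    rw [lintegral_add_left (measurable_decayKernel _)]
    refine ENNReal.add_lt_top.2 ⟨lintegral_decayKernel_lt_top ?_, hg⟩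
    rw [Fintype.card_fin, ← mul_div_assoc, lt_div_iff₀ hq1]
    linarith

end Kernel

/-! ### The inclusion -/

section Inclusion

theorem measurePreserving_perm {N : ℕ} (c : Equiv.Perm (Fin N)) :
    MeasurePreserving (fun (z : Fin N → ℝ) i => z (c i)) := by
  have h := volume_measurePreserving_piCongrLeft (fun _ : Fin N => ℝ) c.symm
  suffices h3 : (fun (z : Fin N → ℝ) i => z (c i)) =
      ⇑(MeasurableEquiv.piCongrLeft (fun _ : Fin N => ℝ) c.symm) by
    rw [h3]; exact h
  funext z i
  have := MeasurableEquiv.piCongrLeft_apply_apply c.symm (β := fun _ : Fin N => ℝ) z (c i)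
  rw [Equiv.symm_apply_apply] at this
  exact this.symm

theorem norm_comp_perm {N : ℕ} (c : Equiv.Perm (Fin N)) (z : Fin N → ℝ) :
    ‖fun i => z (c i)‖ = ‖z‖ := by
  apply le_antisymm
  · exact (pi_norm_le_iff_of_nonneg (norm_nonneg _)).2 fun i => norm_le_pi_norm z (c i)
  · refine (pi_norm_le_iff_of_nonneg (norm_nonneg _)).2 fun i => ?_
    simpa using norm_le_pi_norm (fun i => z (c i)) (c.symm i)

/-- The Euclidean norm dominates the sup norm. Both the inclusion and the failure of membership need
only a lower bound for the weight, so this one-sided comparison suffices. -/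
theorem decayKernel_neg_le_polyWeight {m : ℕ} {s : ℝ} (hs : 0 ≤ s) (z : Fin m → ℝ) :
    decayKernel (-s) z ≤ ENNReal.ofReal (polyWeight s z) := by
  refine ENNReal.ofReal_le_ofReal ?_
  rw [neg_neg]
  refine Real.rpow_le_rpow (by positivity) ?_ hs
  gcongr
  exact (pi_norm_le_iff_of_nonneg (norm_nonneg _)).2 fun i =>
    PiLp.norm_apply_le (WithLp.toLp 2 z : EuclideanSpace ℝ (Fin m)) i

variable {n : ℕ}

local notation "V" => EuclideanSpace ℝ (Fin n)

theorem modulationSpace_subset {s : ℝ} (hs : 0 ≤ s) {p : ℝ≥0∞} (hp1 : 1 ≤ p)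
    (hp : p ≠ ∞ → (n : ℝ) < p.toReal / 2 * (2 * s + n)) (c : Equiv.Perm (Fin (n + n)))
    {φ : 𝓢(V, ℂ)} (hφ : φ ≠ 0) (ψ : 𝓢(V, ℂ)) :
    modulationSpace φ 2 2 (polyWeight s) ⊆
      mixedModulationSpace ψ c
        (Fin.append (fun _ : Fin n => (2 : ℝ≥0∞)) (fun _ : Fin n => p)) (fun _ => 1) := by
  intro f hf
  rw [mem_modulationSpace_iff] at hf
  -- Any order above 2n + s would do: s is spent on Peetre's inequality and the rest must remain
  -- integrable in dimension 2n.
  obtain ⟨C, hC, hb⟩ := exists_enorm_gaborTransformPhase_le hφ ψ (n + n + s + 1 : ℝ)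
  have hcp := measurePreserving_perm c
  have hFm := (continuous_gaborTransformPhase φ f).measurable.enorm
  have hk : ∀ z w : Fin (n + n) → ℝ, decayKernel (n + n + s + 1 : ℝ)
      ((fun i => z (c i)) - fun i => w (c i)) = decayKernel (n + n + s + 1 : ℝ) (z - w) := by
    intro z w
    rw [decayKernel, decayKernel, ← norm_comp_perm c (z - w)]
    rfl
  obtain ⟨g, D, hD, hgD, hg, hG⟩ := exists_slice_bound (m := n) (k := n) hs
    (r := (n + n + s + 1 : ℝ)) (by linarith)
    (A := fun z => ‖gaborTransformPhase ψ f fun i => z (c i)‖ₑ)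
    (F := fun z => ‖gaborTransformPhase φ f fun i => z (c i)‖ₑ)
    (hFm.comp hcp.measurable) hC (fun w => by
      refine (hb f _).trans_eq ?_
      have hm : Measurable fun z => ‖gaborTransformPhase φ f z‖ₑ *
          decayKernel (n + n + s + 1 : ℝ) (z - fun i => w (c i)) :=
        hFm.mul ((measurable_decayKernel _).comp (measurable_id.sub_const _))
      rw [← hcp.lintegral_comp hm]
      simp only [hk]) (by
      refine lt_of_le_of_lt ?_ hf
      have hm : Measurable fun z =>
          (‖gaborTransformPhase φ f z‖ₑ * ENNReal.ofReal (polyWeight s z)) ^ 2 :=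
        (hFm.mul (continuous_polyWeight s).measurable.ennreal_ofReal).pow_const 2
      rw [← hcp.lintegral_comp hm]
      refine lintegral_mono fun z => ?_
      gcongr
      refine le_trans (le_of_eq ?_) (decayKernel_neg_le_polyWeight hs _)
      rw [decayKernel, decayKernel, norm_comp_perm])
  by_cases hpt : p = ∞
  · subst hpt
    refine mem_mixedModulationSpace_top ψ f c hD fun y => (hG y).trans ?_
    exact (mul_le_of_le_one_left' (decayKernel_le_one (by positivity) y)).trans (hgD y)
  · have h0 : p ≠ 0 := (zero_lt_one.trans_le hp1).ne'
    refine mem_mixedModulationSpace_of_lintegral ψ f c h0 hpt ?_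
    exact lintegral_rpow_lt_top hs (by have := ENNReal.toReal_pos h0 hpt; positivity) (hp hpt)
      hD hgD hg hG

end Inclusion

/-! ### Plancherel for integrable, square-integrable functions -/

section Plancherel

variable {n : ℕ}

local notation "V" => EuclideanSpace ℝ (Fin n)

theorem continuous_fourier_of_integrable {h : V → ℂ} (h1 : Integrable h) : Continuous (𝓕 h) :=
  VectorFourier.fourierIntegral_continuous Real.continuous_fourierChar
    (L := innerₗ V) continuous_inner h1

/-- The two transforms are compared as distributions: the L² transform agrees with the
distributional one, and the integral transform satisfies the multiplication formula ∫ ĝ h = ∫ g ĥ.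
-/
theorem fourier_toLp_ae_eq {h : V → ℂ} (h1 : Integrable h) (h2 : MemLp h 2) :
    ∀ᵐ ξ, (𝓕 (h2.toLp h) : Lp ℂ 2 (volume : Measure V)) ξ = 𝓕 h ξ := by
  refine ae_eq_of_integral_contDiff_smul_eq ((Lp.memLp _).locallyIntegrable (by norm_num))
    (continuous_fourier_of_integrable h1).locallyIntegrable fun g hg hgc => ?_
  have hgc' : HasCompactSupport fun x => (g x : ℂ) :=
    hgc.comp_left (g := fun x : ℝ => (x : ℂ)) Complex.ofReal_zero
  set G : 𝓢(V, ℂ) := hgc'.toSchwartzMap (Complex.ofRealCLM.contDiff.comp hg) with hG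
  have hGx : ∀ x, G x = (g x : ℂ) := fun x => rfl
  have e1 := congrArg (fun T : 𝓢'(V, ℂ) => T G)
    (Lp.fourier_toTemperedDistribution_eq (h2.toLp h))
  simp only [TemperedDistribution.fourier_apply, Lp.toTemperedDistribution_apply] at e1
  have e2 : ∫ x, 𝓕 G x • (h2.toLp h : V → ℂ) x = ∫ x, 𝓕 G x • h x := by
    refine integral_congr_ae ?_
    filter_upwards [h2.coeFn_toLp] with x hx
    rw [hx]
  have e3 : ∫ ξ, 𝓕 (G : V → ℂ) ξ • h ξ = ∫ x, G x • 𝓕 h x := by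
    have := VectorFourier.integral_fourierIntegral_smul_eq_flip (μ := (volume : Measure V))
      (ν := (volume : Measure V)) (L := innerₗ V) Real.continuous_fourierChar continuous_inner
      (G.integrable (μ := volume)) h1
    simpa using! this
  rw [e2, SchwartzMap.fourier_coe, e3] at e1
  simp only [hGx, Complex.coe_smul] at e1
  exact e1.symm

/-- Plancherel's theorem on `L¹ ∩ L²`. -/
theorem lintegral_enorm_fourier_sq {h : V → ℂ} (h1 : Integrable h) (h2 : MemLp h 2) :
    ∫⁻ ξ, ‖𝓕 h ξ‖ₑ ^ 2 = ∫⁻ x, ‖h x‖ₑ ^ 2 := by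
  have key : ∀ u : V → ℂ, ∫⁻ x, ‖u x‖ₑ ^ 2 = eLpNorm u 2 volume ^ 2 := by
    intro u
    have := eLpNorm_nnreal_pow_eq_lintegral (f := u) (μ := (volume : Measure V))
      (p := 2) (by norm_num)
    simpa using this.symm
  rw [key, key]
  congr 1
  rw [← eLpNorm_congr_ae (fourier_toLp_ae_eq h1 h2), ← eLpNorm_congr_ae h2.coeFn_toLp]
  have := Lp.norm_fourier_eq (h2.toLp h)
  rw [Lp.norm_def, Lp.norm_def] at this
  exact (ENNReal.toReal_eq_toReal_iff' (Lp.eLpNorm_ne_top _) (Lp.eLpNorm_ne_top _)).1 this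

end Plancherel

/-! ### Bounded functions as tempered distributions -/

section BoundedFunction

variable {n : ℕ}

local notation "V" => EuclideanSpace ℝ (Fin n)

/-- The tempered distribution given by a bounded measurable function with values in `[0, ∞)`. -/
def ofBounded {S : V → ℝ≥0∞} (hS : Measurable S) {C : ℝ≥0∞} (hC : C ≠ ∞) (hb : ∀ t, S t ≤ C) :
    𝓢'(V, ℂ) :=
  Lp.toTemperedDistribution ((memLp_top_of_bound (f := fun t => ((S t).toReal : ℂ)) (μ := volume)
    (Complex.measurable_ofReal.comp hS.ennreal_toReal).aestronglyMeasurable C.toReal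
    (Eventually.of_forall fun t => by
      rw [Complex.norm_real, Real.norm_of_nonneg ENNReal.toReal_nonneg]
      exact ENNReal.toReal_mono hC (hb t))).toLp _)

theorem gaborTransform_ofBounded {S : V → ℝ≥0∞} (hS : Measurable S) {C : ℝ≥0∞} (hC : C ≠ ∞)
    (hb : ∀ t, S t ≤ C) (φ : 𝓢(V, ℂ)) (x ξ : V) :
    gaborTransform φ (ofBounded hS hC hb) x ξ =
      ∫ t, conj (timeFreqShift x ξ φ t) * ((S t).toReal : ℂ) := by
  rw [gaborTransform, ofBounded, Lp.toTemperedDistribution_apply]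
  refine integral_congr_ae ?_
  filter_upwards [MemLp.coeFn_toLp (memLp_top_of_bound (f := fun t => ((S t).toReal : ℂ))
    (μ := volume) (Complex.measurable_ofReal.comp hS.ennreal_toReal).aestronglyMeasurable C.toReal
    (Eventually.of_forall fun t => by
      rw [Complex.norm_real, Real.norm_of_nonneg ENNReal.toReal_nonneg]
      exact ENNReal.toReal_mono hC (hb t)))] with t ht
  rw [ht, conjSchwartz_apply, smul_eq_mul]

/-- For fixed x the transform in ξ is the Fourier transform of the conjugated translated window
times S, a function in L¹ ∩ L², so Plancherel applies. -/
theorem lintegral_enorm_gaborTransform_ofBounded_sq {S : V → ℝ≥0∞} (hS : Measurable S)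
    {C : ℝ≥0∞} (hC : C ≠ ∞) (hb : ∀ t, S t ≤ C) (φ : 𝓢(V, ℂ)) (x : V) :
    ∫⁻ ξ, ‖gaborTransform φ (ofBounded hS hC hb) x ξ‖ₑ ^ 2 =
      ∫⁻ t, ‖φ (t - x)‖ₑ ^ 2 * S t ^ 2 := by
  set h : V → ℂ := fun t => conj (φ (t - x)) * ((S t).toReal : ℂ) with hh
  have hSm : Measurable fun t => ((S t).toReal : ℂ) :=
    Complex.measurable_ofReal.comp hS.ennreal_toReal
  have hSb : ∀ t, ‖((S t).toReal : ℂ)‖ ≤ C.toReal := fun t => by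
    rw [Complex.norm_real, Real.norm_of_nonneg ENNReal.toReal_nonneg]
    exact ENNReal.toReal_mono hC (hb t)
  have hcm : AEStronglyMeasurable h volume :=
    ((Complex.continuous_conj.comp (φ.continuous.comp
      (continuous_id.sub continuous_const))).measurable.mul hSm).aestronglyMeasurable
  have hle : ∀ t, ‖h t‖ ≤ C.toReal * ‖SchwartzMap.compSubConstCLM ℂ x φ t‖ := fun t => by
    rw [hh]
    simp only [norm_mul, RCLike.norm_conj, SchwartzMap.compSubConstCLM_apply]
    rw [mul_comm]
    gcongr
    exact hSb t
  have h1 : Integrable h :=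
    ((SchwartzMap.compSubConstCLM ℂ x φ).integrable.norm.const_mul C.toReal).mono' hcm
      (Eventually.of_forall hle)
  have h2 : MemLp h 2 :=
    (((SchwartzMap.compSubConstCLM ℂ x φ).memLp 2 volume).norm.const_mul C.toReal).mono hcm
      (Eventually.of_forall fun t => (hle t).trans (le_abs_self _))
  have e : ∀ ξ, gaborTransform φ (ofBounded hS hC hb) x ξ = 𝓕 h ξ := fun ξ => by
    rw [gaborTransform_ofBounded, Real.fourier_eq']
    congr 1
    ext t
    rw [timeFreqShift_apply, map_mul, ← Complex.exp_conj, map_mul, Complex.conj_I,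
      Complex.conj_ofReal, smul_eq_mul, hh]
    simp only
    rw [← mul_assoc]
    congr 3
    push_cast
    ring
  simp only [e]
  rw [lintegral_enorm_fourier_sq h1 h2]
  congr 1
  ext t
  rw [hh]
  simp only [enorm_mul]
  rw [mul_pow]
  congr 2
  · rw [← ofReal_norm, RCLike.norm_conj, ofReal_norm]
  · rw [← ofReal_norm, Complex.norm_real, Real.norm_of_nonneg ENNReal.toReal_nonneg,
      ENNReal.ofReal_toReal (ne_top_of_le_ne_top hC (hb t))]

end BoundedFunction

/-! ### Combs and their exclusion from the weighted space -/

section Comb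

variable {n : ℕ} {ι : Type*}

local notation "V" => EuclideanSpace ℝ (Fin n)

/-- The superposition of the translates of `|φ|²` by `y i` with coefficients `a i`. -/
def comb (φ : 𝓢(V, ℂ)) (a : ι → NNReal) (y : ι → V) (t : V) : ℝ≥0∞ :=
  ∑' i, (a i : ℝ≥0∞) * ‖φ (t - y i)‖ₑ ^ 2

theorem measurable_comb [Countable ι] (φ : 𝓢(V, ℂ)) (a : ι → NNReal) (y : ι → V) :
    Measurable (comb φ a y) := by
  refine Measurable.tsum fun i => Measurable.const_mul ?_ _
  exact ((φ.continuous.comp (continuous_id.sub continuous_const)).measurable.enorm).pow_const 2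

/-- `windowed φ φ 0` is |φ|² as a Schwartz function, which makes the decay estimates for
`schwartzGabor` applicable to each tooth of the comb. -/
theorem coe_toReal_comb {φ : 𝓢(V, ℂ)} {a : ι → NNReal} {y : ι → V} {t : V}
    (h : comb φ a y t ≠ ∞) :
    ((comb φ a y t).toReal : ℂ) = ∑' i, (a i : ℂ) * timeFreqShift (y i) 0 (windowed φ φ 0) t := by
  rw [comb, ENNReal.tsum_toReal_eq fun i => ENNReal.ne_top_of_tsum_ne_top h i, Complex.ofReal_tsum]
  refine tsum_congr fun i => ?_
  rw [timeFreqShift_apply, windowed_apply, inner_zero_right, sub_zero,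
    ← Complex.normSq_eq_conj_mul_self, Complex.normSq_eq_norm_sq]
  simp

theorem enorm_ofReal_coe_nnreal (a : NNReal) : ‖((a : ℝ) : ℂ)‖ₑ = a := by
  rw [← ofReal_norm, Complex.norm_real, NNReal.norm_eq, ENNReal.ofReal_coe_nnreal]

theorem enorm_gaborTransform_comb_le [Countable ι] (ψ : 𝓢(V, ℂ)) {φ : 𝓢(V, ℂ)} {a : ι → NNReal}
    {y : ι → V} {C : ℝ≥0∞} (hC : C ≠ ∞) (hb : ∀ t, comb φ a y t ≤ C) (x ξ : V) :
    ‖gaborTransform ψ (ofBounded (measurable_comb φ a y) hC hb) x ξ‖ₑ ≤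
      ∑' i, (a i : ℝ≥0∞) * ‖schwartzGabor ψ (windowed φ φ 0) (x - y i) ξ‖ₑ := by
  set F : ι → V → ℂ := fun i t => conj (timeFreqShift x ξ ψ t) *
    ((a i : ℂ) * timeFreqShift (y i) 0 (windowed φ φ 0) t) with hF
  have hFm : ∀ i, AEStronglyMeasurable (F i) volume := fun i => by
    have h1 := (timeFreqShift x ξ ψ).continuous
    have h2 := (timeFreqShift (y i) 0 (windowed φ φ 0)).continuous
    exact ((Complex.continuous_conj.comp h1).mul (continuous_const.mul h2)).aestronglyMeasurable
  have hFe : ∀ i t, ‖F i t‖ₑ = ‖ψ (t - x)‖ₑ * ((a i : ℝ≥0∞) * ‖φ (t - y i)‖ₑ ^ 2) := by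
    intro i t
    rw [hF]
    simp only
    rw [← ofReal_norm, norm_mul, norm_mul, RCLike.norm_conj, norm_timeFreqShift_apply,
      norm_timeFreqShift_apply, windowed_apply, sub_zero, norm_mul, RCLike.norm_conj, ← pow_two,
      ENNReal.ofReal_mul (by positivity), ENNReal.ofReal_mul (by positivity),
      ENNReal.ofReal_pow (by positivity), ofReal_norm, ofReal_norm,
      ofReal_norm, enorm_ofReal_coe_nnreal]
  have hψ : ∫⁻ t, ‖ψ (t - x)‖ₑ < ∞ := by
    rw [lintegral_sub_right_eq_self (fun t => ‖ψ t‖ₑ) x]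
    exact ψ.integrable.2
  -- The sum of the absolute values is |ψ(t - x)| times the comb, and the comb is bounded by C; this
  -- justifies exchanging sum and integral.
  have hfin : ∑' i, ∫⁻ t, ‖F i t‖ₑ ≠ ∞ := by
    rw [← lintegral_tsum fun i => (hFm i).enorm]
    simp only [hFe, ENNReal.tsum_mul_left]
    refine ne_top_of_le_ne_top (ENNReal.mul_ne_top hψ.ne hC)
      ((lintegral_mono fun t => mul_le_mul_right (hb t) _).trans_eq ?_)
    rw [lintegral_mul_const' _ _ hC]
  have hsum : gaborTransform ψ (ofBounded (measurable_comb φ a y) hC hb) x ξ =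
      ∑' i, (a i : ℂ) * schwartzGabor ψ (timeFreqShift (y i) 0 (windowed φ φ 0)) x ξ := by
    rw [gaborTransform_ofBounded]
    have e1 : ∀ t, conj (timeFreqShift x ξ ψ t) * ((comb φ a y t).toReal : ℂ) = ∑' i, F i t := by
      intro t
      rw [coe_toReal_comb (ne_top_of_le_ne_top hC (hb t)), ← tsum_mul_left]
    simp only [e1]
    rw [integral_tsum hFm hfin]
    refine tsum_congr fun i => ?_
    rw [schwartzGabor_eq_integral, ← integral_const_mul]
    congr 1
    ext t
    rw [hF]
    ring
  rw [hsum]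
  refine enorm_tsum_le_tsum_enorm.trans (ENNReal.tsum_le_tsum fun i => ?_)
  rw [enorm_mul, enorm_ofReal_coe_nnreal, ← ofReal_norm (schwartzGabor _ _ _ _),
    norm_schwartzGabor_timeFreqShift, sub_zero, ofReal_norm]

theorem exists_enorm_gaborTransformPhase_comb_le (ι : Type*) [Countable ι] (ψ φ : 𝓢(V, ℂ)) (r : ℝ) :
    ∃ D : ℝ≥0∞, D ≠ ∞ ∧ ∀ (a : ι → NNReal) (j : Fin n) (τ : ι → ℝ) (C : ℝ≥0∞) (hC : C ≠ ∞)
      (hb : ∀ t, comb φ a (fun i => EuclideanSpace.single j (τ i)) t ≤ C) (z : Fin (n + n) → ℝ),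
      ‖gaborTransformPhase ψ (ofBounded (measurable_comb φ a _) hC hb) z‖ₑ ≤
        D * ∑' i, (a i : ℝ≥0∞) * decayKernel r (z - Pi.single (Fin.castAdd n j) (τ i)) := by
  obtain ⟨D, hD, h⟩ := exists_enorm_schwartzGabor_le ψ (windowed φ φ 0) r
  refine ⟨D, hD, fun a j τ C hC hb z => ?_⟩
  refine (enorm_gaborTransform_comb_le ψ hC hb _ _).trans ?_
  rw [← ENNReal.tsum_mul_left]
  refine ENNReal.tsum_le_tsum fun i => ?_
  rw [mul_left_comm]
  gcongr
  refine le_trans (le_of_eq ?_) (h _)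
  congr 2
  · ext l
    simp [Pi.single_apply]
  · ext l
    have : Fin.natAdd n l ≠ Fin.castAdd n j := by
      intro h
      have := congrArg Fin.val h
      simp only [Fin.val_natAdd, Fin.val_castAdd] at this
      omega
    simp only [Pi.sub_apply, Pi.single_eq_of_ne this, sub_zero]

theorem tsum_sq_le_sq_tsum (f : ι → ℝ≥0∞) : ∑' i, f i ^ 2 ≤ (∑' i, f i) ^ 2 := by
  rw [pow_two, ← ENNReal.tsum_mul_right]
  refine ENNReal.tsum_le_tsum fun i => ?_
  rw [pow_two]
  gcongr
  exact ENNReal.le_tsum i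

theorem decayKernel_ne_top {κ : Type*} [Fintype κ] (r : ℝ) (z : κ → ℝ) : decayKernel r z ≠ ∞ :=
  ENNReal.ofReal_ne_top

theorem decayKernel_mul_decayKernel_neg {κ : Type*} [Fintype κ] (s : ℝ) (z : κ → ℝ) :
    decayKernel (-s) z * decayKernel s z = 1 := by
  rw [← decayKernel_add]
  simp [decayKernel]

theorem lintegral_enorm_pow_ne_zero {φ : 𝓢(V, ℂ)} (hφ : φ ≠ 0) {m : ℕ} (hm : m ≠ 0) :
    ∫⁻ t, ‖φ t‖ₑ ^ m ≠ 0 := by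
  intro h
  rw [lintegral_eq_zero_iff (φ.continuous.measurable.enorm.pow_const m)] at h
  have h2 : (φ : V → ℂ) =ᵐ[volume] fun _ => 0 := by
    filter_upwards [h] with t ht
    simpa [hm] using ht
  exact hφ (SchwartzMap.ext fun t =>
    congrFun ((Continuous.ae_eq_iff_eq volume φ.continuous continuous_const).1 h2) t)

/-- The kernel never vanishes, and without it Tonelli factors the integral as ∫ |φ|² · ∫ |φ|⁴. -/
theorem lintegral_decayKernel_mul_ne_zero {φ : 𝓢(V, ℂ)} (hφ : φ ≠ 0) (s : ℝ) :
    ∫⁻ x : V, decayKernel s x.ofLp ^ 2 * ∫⁻ t, ‖φ (t - x)‖ₑ ^ 2 * ‖φ t‖ₑ ^ 4 ≠ 0 := by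
  have hcm : Measurable fun q : V × V => ‖φ (q.2 - q.1)‖ₑ ^ 2 * ‖φ q.2‖ₑ ^ 4 := by
    have h1 : Continuous fun q : V × V => φ (q.2 - q.1) := by fun_prop
    have h2 : Continuous fun q : V × V => φ q.2 := by fun_prop
    exact (h1.measurable.enorm.pow_const 2).mul (h2.measurable.enorm.pow_const 4)
  have hGm : Measurable fun x : V => ∫⁻ t, ‖φ (t - x)‖ₑ ^ 2 * ‖φ t‖ₑ ^ 4 :=
    Measurable.lintegral_prod_right' hcm
  have hkm : Measurable fun x : V => decayKernel s x.ofLp ^ 2 :=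
    ((measurable_decayKernel s).comp (WithLp.measurable_ofLp 2 _)).pow_const 2
  intro h
  have hm : Measurable fun x : V =>
      decayKernel s x.ofLp ^ 2 * ∫⁻ t, ‖φ (t - x)‖ₑ ^ 2 * ‖φ t‖ₑ ^ 4 := hkm.mul hGm
  rw [lintegral_eq_zero_iff hm] at h
  have h2 : ∫⁻ x : V, ∫⁻ t, ‖φ (t - x)‖ₑ ^ 2 * ‖φ t‖ₑ ^ 4 = 0 := by
    rw [lintegral_eq_zero_iff hGm]
    filter_upwards [h] with x hx
    have hk : decayKernel s x.ofLp ≠ 0 := by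
      intro h0
      have := decayKernel_mul_decayKernel_neg s x.ofLp
      simp [h0] at this
    simpa [hk] using hx
  rw [lintegral_lintegral_swap hcm.aemeasurable] at h2
  have h3 : ∀ t : V, ∫⁻ x : V, ‖φ (t - x)‖ₑ ^ 2 * ‖φ t‖ₑ ^ 4 =
      (∫⁻ x, ‖φ x‖ₑ ^ 2) * ‖φ t‖ₑ ^ 4 := fun t => by
    rw [lintegral_mul_const' _ _ (ENNReal.pow_ne_top enorm_ne_top),
      lintegral_sub_left_eq_self (fun x => ‖φ x‖ₑ ^ 2) t]
  simp only [h3] at h2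
  rw [lintegral_const_mul _ (φ.continuous.measurable.enorm.pow_const 4)] at h2
  exact mul_ne_zero (lintegral_enorm_pow_ne_zero hφ two_ne_zero)
    (lintegral_enorm_pow_ne_zero hφ four_ne_zero) h2

theorem decayKernel_neg_ofLp_le_polyWeight {s : ℝ} (hs : 0 ≤ s) (x ξ : V) :
    decayKernel (-s) x.ofLp ≤ ENNReal.ofReal (polyWeight s (Fin.append x.ofLp ξ.ofLp)) := by
  refine le_trans ?_ (decayKernel_neg_le_polyWeight hs _)
  refine ENNReal.ofReal_le_ofReal ?_
  rw [neg_neg]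
  refine Real.rpow_le_rpow (by positivity) ?_ hs
  gcongr
  exact norm_le_norm_append_left _ _

theorem le_lintegral_gaborTransformPhase_ofBounded {s : ℝ} (hs : 0 ≤ s) (φ : 𝓢(V, ℂ))
    {S : V → ℝ≥0∞} (hS : Measurable S) {C : ℝ≥0∞} (hC : C ≠ ∞) (hb : ∀ t, S t ≤ C) :
    ∫⁻ x : V, decayKernel (-s) x.ofLp ^ 2 * ∫⁻ t, ‖φ (t - x)‖ₑ ^ 2 * S t ^ 2 ≤
      ∫⁻ z, (‖gaborTransformPhase φ (ofBounded hS hC hb) z‖ₑ *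
        ENNReal.ofReal (polyWeight s z)) ^ 2 := by
  have hm : Measurable fun z => (‖gaborTransformPhase φ (ofBounded hS hC hb) z‖ₑ *
      ENNReal.ofReal (polyWeight s z)) ^ 2 :=
    ((continuous_gaborTransformPhase _ _).measurable.enorm.mul
      (continuous_polyWeight s).measurable.ennreal_ofReal).pow_const 2
  rw [lintegral_phase hm]
  refine lintegral_mono fun x => ?_
  rw [← lintegral_enorm_gaborTransform_ofBounded_sq hS hC hb,
    ← lintegral_const_mul' _ _ (ENNReal.pow_ne_top (decayKernel_ne_top _ _))]
  refine lintegral_mono fun ξ => ?_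
  rw [gaborTransformPhase_append, ← mul_pow, mul_comm]
  gcongr
  exact decayKernel_neg_ofLp_le_polyWeight hs x ξ

/-- By Plancherel and positivity the squared norm is at least c₀ Σ a_i² (1 + ‖y_i‖)^{2s}. Only c₀ ≠
0 matters, since the sum is infinite. -/
theorem ofBounded_comb_notMem_modulationSpace [Countable ι] {s : ℝ} (hs : 0 ≤ s)
    {φ : 𝓢(V, ℂ)} (hφ : φ ≠ 0) {a : ι → NNReal} {y : ι → V} {C : ℝ≥0∞}
    (hC : C ≠ ∞) (hb : ∀ t, comb φ a y t ≤ C)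
    (h : ∑' i, ((a i : ℝ≥0∞) * decayKernel (-s) (y i).ofLp) ^ 2 = ∞) :
    ofBounded (measurable_comb φ a y) hC hb ∉ modulationSpace φ 2 2 (polyWeight s) := by
  rw [mem_modulationSpace_iff, not_lt, top_le_iff]
  set G : V → ℝ≥0∞ := fun x => ∫⁻ t, ‖φ (t - x)‖ₑ ^ 2 * ‖φ t‖ₑ ^ 4 with hG
  have hcm : Measurable fun q : V × V => ‖φ (q.2 - q.1)‖ₑ ^ 2 * ‖φ q.2‖ₑ ^ 4 := by
    have h1 : Continuous fun q : V × V => φ (q.2 - q.1) := by fun_prop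
    have h2 : Continuous fun q : V × V => φ q.2 := by fun_prop
    exact (h1.measurable.enorm.pow_const 2).mul (h2.measurable.enorm.pow_const 4)
  have hGm : Measurable G := Measurable.lintegral_prod_right' hcm
  have hkm : ∀ s : ℝ, Measurable fun x : V => decayKernel s x.ofLp ^ 2 := fun s =>
    ((measurable_decayKernel s).comp (WithLp.measurable_ofLp 2 _)).pow_const 2
  have hφm : ∀ x : V, Measurable fun t => ‖φ (t - x)‖ₑ := fun x =>
    (φ.continuous.comp (continuous_id.sub continuous_const)).measurable.enorm
  set c₀ := ∫⁻ x : V, decayKernel s x.ofLp ^ 2 * G x with hc₀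
  -- The cross terms in the square of the comb are nonnegative and are discarded.
  have hslice : ∀ x, ∑' i, (a i : ℝ≥0∞) ^ 2 * G (x - y i) ≤
      ∫⁻ t, ‖φ (t - x)‖ₑ ^ 2 * comb φ a y t ^ 2 := by
    intro x
    have e1 : ∀ i, (a i : ℝ≥0∞) ^ 2 * G (x - y i) =
        ∫⁻ t, ‖φ (t - x)‖ₑ ^ 2 * ((a i : ℝ≥0∞) * ‖φ (t - y i)‖ₑ ^ 2) ^ 2 := fun i => by
      have : G (x - y i) = ∫⁻ t, ‖φ (t - x)‖ₑ ^ 2 * ‖φ (t - y i)‖ₑ ^ 4 := by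
        rw [← lintegral_add_right_eq_self _ (y i)]
        simp only [hG, add_sub_cancel_right]
        congr 1
        ext t
        rw [show t + y i - x = t - (x - y i) by abel]
      rw [this, ← lintegral_const_mul' _ _ (ENNReal.pow_ne_top ENNReal.coe_ne_top)]
      congr 1
      ext t
      ring
    simp only [e1]
    have hm : ∀ i, Measurable fun t =>
        ‖φ (t - x)‖ₑ ^ 2 * ((a i : ℝ≥0∞) * ‖φ (t - y i)‖ₑ ^ 2) ^ 2 := fun i =>
      ((hφm x).pow_const 2).mul ((((hφm (y i)).pow_const 2).const_mul _).pow_const 2)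
    rw [← lintegral_tsum fun i => (hm i).aemeasurable]
    refine lintegral_mono fun t => ?_
    simp only
    rw [ENNReal.tsum_mul_left]
    gcongr
    exact tsum_sq_le_sq_tsum _
  -- After translation by y_i, Peetre's inequality bounds the weight at x + y_i below by the weight
  -- at y_i times (1 + ‖x‖)^{-s}. The latter factor is the kernel in c₀.
  have hshift : ∀ i, decayKernel (-s) (y i).ofLp ^ 2 * c₀ ≤
      ∫⁻ x : V, decayKernel (-s) x.ofLp ^ 2 * G (x - y i) := by
    intro i
    rw [← lintegral_add_right_eq_self _ (y i),
      ← lintegral_const_mul' _ _ (ENNReal.pow_ne_top (decayKernel_ne_top _ _))]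
    refine lintegral_mono fun x => ?_
    rw [add_sub_cancel_right, ← mul_assoc, ← mul_pow]
    gcongr
    have hp := decayKernel_peetre hs ((x + y i).ofLp) (y i).ofLp
    rw [WithLp.ofLp_add, add_sub_cancel_right] at hp
    calc _ ≤ decayKernel (-s) (y i).ofLp *
          (decayKernel s (y i).ofLp * decayKernel (-s) (x.ofLp + (y i).ofLp)) := by gcongr
      _ = _ := by rw [← mul_assoc, decayKernel_mul_decayKernel_neg, one_mul, WithLp.ofLp_add]
  have htop : ∞ ≤ ∫⁻ x : V, decayKernel (-s) x.ofLp ^ 2 *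
      ∑' i, (a i : ℝ≥0∞) ^ 2 * G (x - y i) := by
    have hGs : ∀ i, Measurable fun x => G (x - y i) := fun i =>
      hGm.comp (measurable_id.sub_const (y i))
    simp only [← ENNReal.tsum_mul_left]
    have hm : ∀ i, Measurable fun x : V => decayKernel (-s) x.ofLp ^ 2 *
        ((a i : ℝ≥0∞) ^ 2 * G (x - y i)) := fun i => (hkm _).mul ((hGs i).const_mul _)
    rw [lintegral_tsum fun i => (hm i).aemeasurable]
    calc (∞ : ℝ≥0∞) = (∑' i, ((a i : ℝ≥0∞) * decayKernel (-s) (y i).ofLp) ^ 2) * c₀ := by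
          rw [h, ENNReal.top_mul (lintegral_decayKernel_mul_ne_zero hφ s)]
      _ = ∑' i, (a i : ℝ≥0∞) ^ 2 * (decayKernel (-s) (y i).ofLp ^ 2 * c₀) := by
          rw [← ENNReal.tsum_mul_right]
          refine tsum_congr fun i => ?_
          ring
      _ ≤ _ := by
          refine ENNReal.tsum_le_tsum fun i => ?_
          refine (mul_le_mul_right (hshift i) _).trans_eq ?_
          rw [← lintegral_const_mul' _ _ (ENNReal.pow_ne_top ENNReal.coe_ne_top)]
          congr 1
          ext x
          ring
  refine top_le_iff.1 (htop.trans (le_trans (lintegral_mono fun x => ?_)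
    (le_lintegral_gaborTransformPhase_ofBounded hs φ (measurable_comb φ a y) hC hb)))
  gcongr
  exact hslice x

end Comb

/-! ### Combs in the mixed space -/

section CombMixedNorm

variable {n : ℕ} {ι : Type*}

local notation "V" => EuclideanSpace ℝ (Fin n)

/-- Jensen's inequality for the counting measure. -/
theorem tsum_mul_rpow_le {q : ℝ} (hq : 1 ≤ q) (f k : ι → ℝ≥0∞) :
    (∑' i, f i * k i) ^ q ≤ (∑' i, k i) ^ (q - 1) * ∑' i, f i ^ q * k i := by
  let _ : MeasurableSpace ι := ⊤
  have h := lintegral_mul_rpow_le (μ := (Measure.count : Measure ι)) hq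
    (f := f) (k := k) measurable_from_top measurable_from_top
  simpa only [lintegral_count] using h

/-- Doubling the order allows half of the decay to be spent on each block, so the L² block and the
L^p block separate. -/
theorem decayKernel_append_le {m k : ℕ} {r : ℝ} (hr : 0 ≤ r) (x : Fin m → ℝ) (y : Fin k → ℝ) :
    decayKernel (r + r) (Fin.append x y) ≤ decayKernel r x * decayKernel r y := by
  rw [decayKernel_add]
  gcongr
  · exact decayKernel_anti hr (norm_le_norm_append_left x y)
  · exact decayKernel_anti hr (norm_le_norm_append_right x y)

theorem append_sub_single_castAdd {m k : ℕ} (x : Fin m → ℝ) (y : Fin k → ℝ) (l : Fin m) (t : ℝ) :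
    Fin.append x y - Pi.single (Fin.castAdd k l) t = Fin.append (x - Pi.single l t) y := by
  ext i
  refine Fin.addCases (fun i => ?_) (fun i => ?_) i
  · simp [Pi.single_apply]
  · have : Fin.natAdd m i ≠ Fin.castAdd k l := by
      intro h
      have := congrArg Fin.val h
      simp only [Fin.val_natAdd, Fin.val_castAdd] at this
      omega
    rw [Pi.sub_apply, Pi.single_eq_of_ne this, Fin.append_right, Fin.append_right, sub_zero]

theorem append_sub_single_natAdd {m k : ℕ} (x : Fin m → ℝ) (y : Fin k → ℝ) (l : Fin k) (t : ℝ) :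
    Fin.append x y - Pi.single (Fin.natAdd m l) t = Fin.append x (y - Pi.single l t) := by
  ext i
  refine Fin.addCases (fun i => ?_) (fun i => ?_) i
  · have : Fin.castAdd k i ≠ Fin.natAdd m l := by
      intro h
      have := congrArg Fin.val h
      simp only [Fin.val_natAdd, Fin.val_castAdd] at this
      omega
    rw [Pi.sub_apply, Pi.single_eq_of_ne this, Fin.append_left, Fin.append_left, sub_zero]
  · simp only [Pi.sub_apply, Pi.single_apply, Fin.append_right]
    congr 2
    simp [Fin.ext_iff]

/-- Coordinate i of the phase variable is w_{c(i)}, so a translation in position direction j becomes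
one in coordinate c(j). The block containing c(j) decides which norm sees the spread of the comb. -/
theorem exists_enorm_gaborTransformPhase_comb_perm_le (ι : Type*) [Countable ι] (ψ φ : 𝓢(V, ℂ))
    (c : Equiv.Perm (Fin (n + n))) (r : ℝ) :
    ∃ D : ℝ≥0∞, D ≠ ∞ ∧ ∀ (a : ι → NNReal) (j : Fin n) (τ : ι → ℝ) (C : ℝ≥0∞) (hC : C ≠ ∞)
      (hb : ∀ t, comb φ a (fun i => EuclideanSpace.single j (τ i)) t ≤ C) (w : Fin (n + n) → ℝ),
      ‖gaborTransformPhase ψ (ofBounded (measurable_comb φ a _) hC hb) fun i => w (c i)‖ₑ ≤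
        D * ∑' i, (a i : ℝ≥0∞) * decayKernel r (w - Pi.single (c (Fin.castAdd n j)) (τ i)) := by
  obtain ⟨D, hD, h⟩ := exists_enorm_gaborTransformPhase_comb_le ι ψ φ r
  refine ⟨D, hD, fun a j τ C hC hb w => (h a j τ C hC hb _).trans_eq ?_⟩
  congr 2
  ext i
  rw [decayKernel, decayKernel, ← norm_comp_perm c (w - _)]
  congr 6
  ext l
  simp [Pi.single_apply]

theorem exists_comb_le (φ : 𝓢(V, ℂ)) (m : ℕ) :
    ∃ M : ℝ≥0∞, M ≠ ∞ ∧ ∀ (a : ι → NNReal) (j : Fin n) (τ : ι → ℝ) (t : V),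
      comb φ a (fun i => EuclideanSpace.single j (τ i)) t ≤
        M * ∑' i, (a i : ℝ≥0∞) * decayKernel m (t.ofLp - Pi.single j (τ i)) := by
  have key : ∀ t : V, ‖φ t‖ₑ ^ 2 ≤
      ENNReal.ofReal (2 ^ m * orderSeminorm V m (windowed φ φ 0)) * decayKernel m t.ofLp := by
    intro t
    have h := one_add_pow_mul_norm_le_orderSeminorm m (windowed φ φ 0) t
    rw [windowed_apply, sub_zero, norm_mul, RCLike.norm_conj, ← pow_two] at h
    rw [← ofReal_norm, ← ENNReal.ofReal_pow (norm_nonneg _), decayKernel,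
      ← ENNReal.ofReal_mul (by positivity), Real.rpow_neg (by positivity), Real.rpow_natCast]
    refine ENNReal.ofReal_le_ofReal ?_
    rw [← div_eq_mul_inv, le_div_iff₀ (by positivity), mul_comm]
    refine le_trans ?_ h
    gcongr
    exact (pi_norm_le_iff_of_nonneg (norm_nonneg _)).2 fun i => PiLp.norm_apply_le t i
  refine ⟨ENNReal.ofReal (2 ^ m * orderSeminorm V m (windowed φ φ 0)), ENNReal.ofReal_ne_top,
    fun a j τ t => ?_⟩
  rw [comb, ← ENNReal.tsum_mul_left]
  refine ENNReal.tsum_le_tsum fun i => ?_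
  rw [mul_left_comm]
  gcongr
  exact key _

theorem measurable_decayKernel_sub {m : ℕ} (r : ℝ) (v : Fin m → ℝ) :
    Measurable fun x : Fin m → ℝ => decayKernel r (x - v) :=
  (measurable_decayKernel r).comp (measurable_id.sub_const v)

/-- Translates along a direction over which the square norm is taken. -/
theorem ofBounded_comb_mem_of_castAdd [Countable ι] (ψ : 𝓢(V, ℂ)) {φ : 𝓢(V, ℂ)} {a : ι → NNReal}
    {j : Fin n} {τ : ι → ℝ} {C : ℝ≥0∞} (hC : C ≠ ∞)
    (hb : ∀ t, comb φ a (fun i => EuclideanSpace.single j (τ i)) t ≤ C)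
    {p : ℝ≥0∞} (hp1 : 1 ≤ p) {c : Equiv.Perm (Fin (n + n))} {l : Fin n}
    (hl : c (Fin.castAdd n j) = Fin.castAdd n l) (ha : ∑' i, (a i : ℝ≥0∞) ≠ ∞) :
    ofBounded (measurable_comb φ a _) hC hb ∈ mixedModulationSpace ψ c
      (Fin.append (fun _ : Fin n => (2 : ℝ≥0∞)) (fun _ : Fin n => p)) (fun _ => 1) := by
  obtain ⟨r, hr⟩ : ∃ r : ℝ, r = n + 1 := ⟨_, rfl⟩
  have hr0 : 0 ≤ r := by rw [hr]; positivity
  obtain ⟨D, hD, h⟩ := exists_enorm_gaborTransformPhase_comb_perm_le ι ψ φ c (r + r)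
  set f := ofBounded (measurable_comb φ a _) hC hb with hf
  set A := ∑' i, (a i : ℝ≥0∞) with hA
  set I := ∫⁻ x : Fin n → ℝ, decayKernel r x with hI
  have hItop : I ≠ ∞ := (lintegral_decayKernel_lt_top (by simp [hr])).ne
  have hpt : ∀ x y, ‖gaborTransformPhase ψ f fun i => Fin.append x y (c i)‖ₑ ^ 2 ≤
      D ^ 2 * decayKernel (r + r) y * A *
        ∑' i, (a i : ℝ≥0∞) * decayKernel r (x - Pi.single l (τ i)) := by
    intro x y
    calc _ ≤ (D * ∑' i, (a i : ℝ≥0∞) *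
          (decayKernel r (x - Pi.single l (τ i)) * decayKernel r y)) ^ 2 := by
          refine pow_le_pow_left' ((h a j τ C hC hb _).trans ?_) 2
          gcongr with i
          rw [hl, append_sub_single_castAdd]
          exact decayKernel_append_le hr0 _ _
      _ = D ^ 2 * decayKernel (r + r) y *
          (∑' i, decayKernel r (x - Pi.single l (τ i)) * (a i : ℝ≥0∞)) ^ 2 := by
          simp only [← mul_assoc]
          rw [ENNReal.tsum_mul_right, decayKernel_add]
          simp only [mul_comm (decayKernel r (x - _))]
          ring
      -- Jensen with the coefficients as weights, so that only Σ a_i enters and the positions of the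
      -- translates play no role.
      _ ≤ D ^ 2 * decayKernel (r + r) y * (A *
          ∑' i, decayKernel r (x - Pi.single l (τ i)) ^ 2 * (a i : ℝ≥0∞)) := by
          gcongr
          have := tsum_mul_rpow_le (q := 2) one_le_two
            (fun i => decayKernel r (x - Pi.single l (τ i))) fun i => (a i : ℝ≥0∞)
          simpa [show (2 : ℝ) - 1 = 1 by norm_num] using this
      _ ≤ _ := by
          rw [← mul_assoc]
          refine mul_le_mul_right (ENNReal.tsum_le_tsum fun i => ?_) _
          rw [mul_comm]
          gcongr
          exact pow_le_of_le_one zero_le (decayKernel_le_one hr0 _) two_ne_zero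
  have hin : ∀ y, innerSq ψ f c y ≤ D ^ 2 * A * (A * I) * decayKernel (r + r) y := by
    intro y
    refine (lintegral_mono fun x => hpt x y).trans_eq ?_
    rw [lintegral_const_mul' _ _ (ENNReal.mul_ne_top (ENNReal.mul_ne_top (ENNReal.pow_ne_top hD)
      (decayKernel_ne_top _ _)) ha),
      lintegral_tsum fun i => ((measurable_decayKernel_sub r _).const_mul _).aemeasurable]
    have : ∀ i, ∫⁻ x : Fin n → ℝ, (a i : ℝ≥0∞) * decayKernel r (x - Pi.single l (τ i)) =
        (a i : ℝ≥0∞) * I := fun i => by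
      rw [lintegral_const_mul' _ _ ENNReal.coe_ne_top, lintegral_decayKernel_sub]
    simp only [this]
    rw [ENNReal.tsum_mul_right]
    ring
  have hK : D ^ 2 * A * (A * I) ≠ ∞ := ENNReal.mul_ne_top
    (ENNReal.mul_ne_top (ENNReal.pow_ne_top hD) ha) (ENNReal.mul_ne_top ha hItop)
  by_cases hpt : p = ∞
  · subst hpt
    exact mem_mixedModulationSpace_top ψ f c hK fun y => (hin y).trans
      (mul_le_of_le_one_right' (decayKernel_le_one (by positivity) y))
  · have h0 : p ≠ 0 := (zero_lt_one.trans_le hp1).ne'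
    have hp1' : 1 ≤ p.toReal := by simpa using ENNReal.toReal_mono hpt hp1
    have hq : 0 ≤ p.toReal / 2 := by positivity
    refine mem_mixedModulationSpace_of_lintegral ψ f c h0 hpt ?_
    refine (lintegral_mono fun y => ENNReal.rpow_le_rpow (hin y) hq).trans_lt ?_
    have hK' := ENNReal.rpow_lt_top_of_nonneg hq hK
    simp only [ENNReal.mul_rpow_of_nonneg _ _ hq, decayKernel_rpow _ _ hq]
    simp only [← ENNReal.mul_rpow_of_nonneg _ _ hq]
    rw [lintegral_const_mul' _ _ hK'.ne]
    refine ENNReal.mul_lt_top hK' (lintegral_decayKernel_lt_top ?_)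
    rw [Fintype.card_fin, hr]
    -- The order is 2r · p/2 = (n + 1)p, which exceeds n because p ≥ 1.
    nlinarith [(Nat.cast_nonneg n : (0 : ℝ) ≤ n)]

/-- Translates along a direction over which the `p`-norm is taken. -/
theorem ofBounded_comb_mem_of_natAdd [Countable ι] (ψ : 𝓢(V, ℂ)) {φ : 𝓢(V, ℂ)} {a : ι → NNReal}
    {j : Fin n} {τ : ι → ℝ} {C : ℝ≥0∞} (hC : C ≠ ∞)
    (hb : ∀ t, comb φ a (fun i => EuclideanSpace.single j (τ i)) t ≤ C)
    {p : ℝ≥0∞} (hp1 : 1 ≤ p) {c : Equiv.Perm (Fin (n + n))} {l : Fin n}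
    (hl : c (Fin.castAdd n j) = Fin.natAdd n l) (ha : ∀ i, a i ≤ 1)
    (hap : p ≠ ∞ → ∑' i, (a i : ℝ≥0∞) ^ p.toReal ≠ ∞) {r : ℝ} (hr : (n : ℝ) < r) {K : ℝ≥0∞}
    (hK : K ≠ ∞) (hτ : ∀ y : Fin n → ℝ, ∑' i, decayKernel r (y - Pi.single l (τ i)) ≤ K) :
    ofBounded (measurable_comb φ a _) hC hb ∈ mixedModulationSpace ψ c
      (Fin.append (fun _ : Fin n => (2 : ℝ≥0∞)) (fun _ : Fin n => p)) (fun _ => 1) := by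
  have hr0 : 0 ≤ r := (Nat.cast_nonneg n).trans hr.le
  obtain ⟨D, hD, h⟩ := exists_enorm_gaborTransformPhase_comb_perm_le ι ψ φ c (r + r)
  set f := ofBounded (measurable_comb φ a _) hC hb with hf
  set I := ∫⁻ x : Fin n → ℝ, decayKernel r x with hI
  have hItop : I ≠ ∞ := (lintegral_decayKernel_lt_top (by simpa using hr)).ne
  set Q : (Fin n → ℝ) → ℝ≥0∞ := fun y =>
    ∑' i, (a i : ℝ≥0∞) * decayKernel r (y - Pi.single l (τ i)) with hQ
  have hQK : ∀ y, Q y ≤ K := fun y => by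
    refine le_trans (ENNReal.tsum_le_tsum fun i => ?_) (hτ y)
    exact mul_le_of_le_one_left' (by exact_mod_cast ha i)
  have hpt : ∀ x y, ‖gaborTransformPhase ψ f fun i => Fin.append x y (c i)‖ₑ ^ 2 ≤
      D ^ 2 * Q y ^ 2 * decayKernel r x := by
    intro x y
    calc _ ≤ (D * ∑' i, (a i : ℝ≥0∞) *
          (decayKernel r x * decayKernel r (y - Pi.single l (τ i)))) ^ 2 := by
          refine pow_le_pow_left' ((h a j τ C hC hb _).trans ?_) 2
          gcongr with i
          rw [hl, append_sub_single_natAdd]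
          exact decayKernel_append_le hr0 _ _
      _ = D ^ 2 * Q y ^ 2 * decayKernel r x ^ 2 := by
          simp only [mul_left_comm _ (decayKernel r x)]
          rw [ENNReal.tsum_mul_left]
          ring
      _ ≤ _ := by
          gcongr
          exact pow_le_of_le_one zero_le (decayKernel_le_one hr0 _) two_ne_zero
  have hin : ∀ y, innerSq ψ f c y ≤ D ^ 2 * I * Q y ^ 2 := by
    intro y
    refine (lintegral_mono fun x => hpt x y).trans_eq ?_
    rw [lintegral_const_mul _ (measurable_decayKernel r)]
    ring
  have hDI : D ^ 2 * I ≠ ∞ := ENNReal.mul_ne_top (ENNReal.pow_ne_top hD) hItop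
  by_cases hpt : p = ∞
  · subst hpt
    refine mem_mixedModulationSpace_top ψ f c (C := D ^ 2 * I * K ^ 2)
      (ENNReal.mul_ne_top hDI (ENNReal.pow_ne_top hK)) fun y => (hin y).trans ?_
    gcongr
    exact hQK y
  · have h0 : p ≠ 0 := (zero_lt_one.trans_le hp1).ne'
    have hp1' : 1 ≤ p.toReal := by simpa using ENNReal.toReal_mono hpt hp1
    have hq : 0 ≤ p.toReal / 2 := by positivity
    refine mem_mixedModulationSpace_of_lintegral ψ f c h0 hpt ?_
    -- Here Jensen takes the kernels as weights; their sum is at most K because the centres are well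
    -- spread. The coefficients thus enter through Σ a_i^p.
    have hQp : ∀ y, innerSq ψ f c y ^ (p.toReal / 2) ≤ (D ^ 2 * I) ^ (p.toReal / 2) *
        (K ^ (p.toReal - 1) *
          ∑' i, (a i : ℝ≥0∞) ^ p.toReal * decayKernel r (y - Pi.single l (τ i))) := by
      intro y
      refine (ENNReal.rpow_le_rpow (hin y) hq).trans ?_
      rw [ENNReal.mul_rpow_of_nonneg _ _ hq, ← ENNReal.rpow_natCast (Q y), ← ENNReal.rpow_mul,
        show ((2 : ℕ) : ℝ) * (p.toReal / 2) = p.toReal by push_cast; ring]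
      gcongr
      refine (tsum_mul_rpow_le hp1' _ _).trans ?_
      exact mul_le_mul_left (ENNReal.rpow_le_rpow (hτ y) (by linarith)) _
    refine (lintegral_mono hQp).trans_lt ?_
    have hK1 := ENNReal.rpow_lt_top_of_nonneg hq hDI
    have hK2 := ENNReal.rpow_lt_top_of_nonneg (sub_nonneg.2 hp1') hK
    rw [lintegral_const_mul' _ _ hK1.ne, lintegral_const_mul' _ _ hK2.ne,
      lintegral_tsum fun i => ((measurable_decayKernel_sub r _).const_mul _).aemeasurable]
    have : ∀ i, ∫⁻ x : Fin n → ℝ, (a i : ℝ≥0∞) ^ p.toReal *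
        decayKernel r (x - Pi.single l (τ i)) = (a i : ℝ≥0∞) ^ p.toReal * I := fun i => by
      rw [lintegral_const_mul _ (measurable_decayKernel_sub r _), lintegral_decayKernel_sub]
    simp only [this]
    rw [ENNReal.tsum_mul_right]
    exact ENNReal.mul_lt_top hK1 (ENNReal.mul_lt_top hK2
      (ENNReal.mul_lt_top (hap hpt).lt_top hItop.lt_top))

end CombMixedNorm

/-! ### Sums over the integers -/

section Lattice

theorem summable_one_add_natAbs_rpow {b : ℝ} (hb : b < -1) :
    Summable fun m : ℤ => (1 + (m.natAbs : NNReal)) ^ b := by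
  have h : Summable fun k : ℕ => (1 + (k : NNReal)) ^ b := by
    have := (NNReal.summable_nat_add_iff 1).2 (NNReal.summable_rpow.2 hb)
    refine this.congr fun k => ?_
    push_cast
    rw [add_comm]
  rw [← NNReal.summable_coe] at h ⊢
  exact Summable.of_nat_of_neg (by simpa using h) (by simpa using h)

theorem not_summable_one_add_natAbs_rpow :
    ¬ Summable fun m : ℤ => (1 + (m.natAbs : NNReal)) ^ (-1 : ℝ) := by
  intro h
  have h1 : Summable fun k : ℕ => (1 + (k : NNReal)) ^ (-1 : ℝ) := by
    rw [← NNReal.summable_coe] at h ⊢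
    simpa [Function.comp_def] using h.comp_injective Nat.cast_injective
  have h2 : Summable fun k : ℕ => ((k + 1 : ℕ) : NNReal) ^ (-1 : ℝ) := by
    refine h1.congr fun k => ?_
    push_cast
    rw [add_comm]
  have := NNReal.summable_rpow.1 ((NNReal.summable_nat_add_iff (f := fun k : ℕ =>
    (k : NNReal) ^ (-1 : ℝ)) 1).1 h2)
  exact lt_irrefl _ this

theorem exists_tsum_decayKernel_lattice_le {k : ℕ} (l : Fin k) {r : ℝ} (hr : 1 < r) :
    ∃ K : ℝ≥0∞, K ≠ ∞ ∧ ∀ y : Fin k → ℝ,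
      ∑' m : ℤ, decayKernel r (y - Pi.single l (m : ℝ)) ≤ K := by
  have hs := summable_one_add_natAbs_rpow (b := -r) (by linarith)
  refine ⟨ENNReal.ofReal (2 ^ r) * ∑' m : ℤ, (((1 + (m.natAbs : NNReal)) ^ (-r) : NNReal) : ℝ≥0∞),
    ENNReal.mul_ne_top ENNReal.ofReal_ne_top (ENNReal.tsum_coe_ne_top_iff_summable.2 hs),
    fun y => ?_⟩
  -- Reindexing by m ↦ ⌊y_l⌋ - m puts the m-th centre at distance at least |m| - 1 from y. Hence 1 +
  -- ‖u‖ ≥ (1 + |m|)/2, which is the source of the factor 2^r.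
  rw [← ENNReal.tsum_mul_left, ← (Equiv.subLeft ⌊y l⌋).tsum_eq]
  refine ENNReal.tsum_le_tsum fun m => ?_
  rw [Equiv.subLeft_apply, ← ENNReal.ofReal_coe_nnreal, ← ENNReal.ofReal_mul (by positivity)]
  refine ENNReal.ofReal_le_ofReal ?_
  set u : Fin k → ℝ := y - Pi.single l ((⌊y l⌋ - m : ℤ) : ℝ) with hu
  have h1 : |y l - (⌊y l⌋ - m)| ≤ ‖u‖ := by
    simpa [hu] using norm_le_pi_norm u l
  have h2 : |(m : ℝ)| ≤ 1 + ‖u‖ := by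
    have h3 := Int.floor_le (y l)
    have h4 := Int.lt_floor_add_one (y l)
    rw [abs_le] at h1 ⊢
    constructor <;> linarith
  have h5 : (1 + |(m : ℝ)|) / 2 ≤ 1 + ‖u‖ := by linarith [norm_nonneg u]
  calc (1 + ‖u‖) ^ (-r) ≤ ((1 + |(m : ℝ)|) / 2) ^ (-r) :=
        Real.rpow_le_rpow_of_nonpos (by positivity) h5 (by linarith)
    _ = 2 ^ r * (1 + |(m : ℝ)|) ^ (-r) := by
        rw [Real.div_rpow (by positivity) (by positivity), Real.rpow_neg zero_le_two,
          div_inv_eq_mul, mul_comm]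
    _ = _ := by
        rw [NNReal.coe_rpow]
        push_cast
        rw [Nat.cast_natAbs, Int.cast_abs]

end Lattice

/-! ### The separating examples -/

section Examples

variable {n : ℕ}

local notation "V" => EuclideanSpace ℝ (Fin n)

theorem decayKernel_single {k : ℕ} (r : ℝ) (j : Fin k) (t : ℝ) :
    decayKernel r (EuclideanSpace.single j t).ofLp = ENNReal.ofReal ((1 + |t|) ^ (-r)) := by
  have h : ‖(EuclideanSpace.single j t).ofLp‖ = ‖t‖ := by
    rw [PiLp.ofLp_single, Pi.norm_single]
  rw [decayKernel, h, Real.norm_eq_abs]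

/-- With a_i = 2^{-i} and |y_i| = 2^{i/s} the coefficients are summable, while every weighted
coefficient a_i (1 + |y_i|)^s is at least 1. -/
theorem exists_mem_notMem_of_castAdd {s : ℝ} (hs : 0 < s) {p : ℝ≥0∞} (hp1 : 1 ≤ p)
    {c : Equiv.Perm (Fin (n + n))} {j l : Fin n} (hl : c (Fin.castAdd n j) = Fin.castAdd n l)
    {φ : 𝓢(V, ℂ)} (hφ : φ ≠ 0) (ψ : 𝓢(V, ℂ)) :
    ∃ f ∈ mixedModulationSpace ψ c
      (Fin.append (fun _ : Fin n => (2 : ℝ≥0∞)) (fun _ : Fin n => p)) (fun _ => 1),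
      f ∉ modulationSpace φ 2 2 (polyWeight s) := by
  set a : ℕ → NNReal := fun i => (1 / 2) ^ i with ha
  set τ : ℕ → ℝ := fun i => (2 ^ i : ℝ) ^ s⁻¹ with hτ
  have hA : ∑' i, (a i : ℝ≥0∞) ≠ ∞ :=
    ENNReal.tsum_coe_ne_top_iff_summable.2 (NNReal.summable_geometric (by
      rw [← NNReal.coe_lt_coe]; norm_num))
  -- Order 0 is enough: the coefficients are summable, so no decay of |φ|² is needed to bound the
  -- comb.
  obtain ⟨M, hM, hMb⟩ := exists_comb_le (ι := ℕ) φ 0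
  have hb : ∀ t, comb φ a (fun i => EuclideanSpace.single j (τ i)) t ≤ M * ∑' i, (a i : ℝ≥0∞) := by
    intro t
    refine (hMb a j τ t).trans ?_
    gcongr with i
    exact mul_le_of_le_one_right' (decayKernel_le_one (by simp) _)
  have hC : M * ∑' i, (a i : ℝ≥0∞) ≠ ∞ := ENNReal.mul_ne_top hM hA
  refine ⟨_, ofBounded_comb_mem_of_castAdd ψ hC hb hp1 hl hA,
    ofBounded_comb_notMem_modulationSpace hs.le hφ hC hb ?_⟩
  rw [← top_le_iff, ← ENNReal.tsum_const_eq_top_of_ne_zero (α := ℕ) one_ne_zero]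
  refine ENNReal.tsum_le_tsum fun i => one_le_pow₀ ?_
  rw [decayKernel_single, neg_neg, ← ENNReal.ofReal_coe_nnreal,
    ← ENNReal.ofReal_mul (by positivity), ENNReal.one_le_ofReal]
  have h1 : (2 : ℝ) ^ i ≤ (1 + |τ i|) ^ s := by
    calc (2 : ℝ) ^ i = τ i ^ s := by
          rw [hτ, ← Real.rpow_mul (by positivity), inv_mul_cancel₀ hs.ne', Real.rpow_one]
      _ ≤ _ := Real.rpow_le_rpow (by positivity) (by linarith [le_abs_self (τ i)]) hs.le
  calc (1 : ℝ) = (1 / 2) ^ i * 2 ^ i := by rw [← mul_pow]; norm_num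
    _ ≤ (1 / 2) ^ i * (1 + |τ i|) ^ s := by gcongr
    _ = _ := by rw [ha]; push_cast; rfl

/-- The coefficients (1 + |m|)^{-1/2} at the integer points lie in ℓ^p for every p > 2 but not in
ℓ². -/
theorem exists_mem_notMem_of_natAdd {p : ℝ≥0∞} (hp : 2 < p)
    {c : Equiv.Perm (Fin (n + n))} {j l : Fin n} (hl : c (Fin.castAdd n j) = Fin.natAdd n l)
    {φ : 𝓢(V, ℂ)} (hφ : φ ≠ 0) (ψ : 𝓢(V, ℂ)) :
    ∃ f ∈ mixedModulationSpace ψ c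
      (Fin.append (fun _ : Fin n => (2 : ℝ≥0∞)) (fun _ : Fin n => p)) (fun _ => 1),
      f ∉ modulationSpace φ 2 2 (polyWeight 0) := by
  set a : ℤ → NNReal := fun m => (1 + (m.natAbs : NNReal)) ^ (-(1 / 2) : ℝ) with ha
  have ha1 : ∀ m, a m ≤ 1 := fun m =>
    NNReal.rpow_le_one_of_one_le_of_nonpos (by simp) (by norm_num)
  -- The order n + 2 exceeds both 1, for the lattice sums, and n, for integrability over ℝⁿ.
  have hr : 1 < ((n + 2 : ℕ) : ℝ) := by
    push_cast; linarith [(Nat.cast_nonneg n : (0 : ℝ) ≤ n)]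
  obtain ⟨K, hK, hKb⟩ := exists_tsum_decayKernel_lattice_le l hr
  obtain ⟨K', hK', hKb'⟩ := exists_tsum_decayKernel_lattice_le j hr
  obtain ⟨M, hM, hMb⟩ := exists_comb_le (ι := ℤ) φ (n + 2)
  have hb : ∀ t, comb φ a (fun i => EuclideanSpace.single j (i : ℝ)) t ≤ M * K' := by
    intro t
    refine (hMb a j _ t).trans ?_
    gcongr
    refine le_trans (ENNReal.tsum_le_tsum fun i => ?_) (hKb' t.ofLp)
    exact mul_le_of_le_one_left' (by exact_mod_cast ha1 i)
  have hC : M * K' ≠ ∞ := ENNReal.mul_ne_top hM hK'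
  refine ⟨_, ofBounded_comb_mem_of_natAdd ψ hC hb (one_le_two.trans hp.le) hl ha1 (fun hpt => ?_)
    (by push_cast; linarith) hK hKb, ofBounded_comb_notMem_modulationSpace le_rfl hφ hC hb ?_⟩
  · have hp2 : 2 < p.toReal := by
      simpa using (ENNReal.toReal_lt_toReal (by simp) hpt).2 hp
    simp only [← ENNReal.coe_rpow_of_nonneg _ (zero_le_two.trans hp2.le)]
    refine ENNReal.tsum_coe_ne_top_iff_summable.2 ?_
    simp only [ha, ← NNReal.rpow_mul]
    exact summable_one_add_natAbs_rpow (by linarith)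
  · by_contra h
    refine not_summable_one_add_natAbs_rpow (ENNReal.tsum_coe_ne_top_iff_summable.1
      (ne_of_eq_of_ne (tsum_congr fun m => ?_) h))
    rw [decayKernel_single, neg_neg, Real.rpow_zero, ENNReal.ofReal_one, mul_one,
      ← ENNReal.coe_pow, ha]
    congr 1
    simp only
    rw [← NNReal.rpow_natCast, ← NNReal.rpow_mul]
    norm_num

end Examples

end MixedMod

end

/-- Both spaces may be taken with arbitrary, possibly different, nonzero Schwartz windows. -/
theorem lemma5p3 (d : ℕ) (hd : 1 ≤ d) (s : ℝ) (hs : 0 ≤ s)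
    (p : ℝ≥0∞) (hp1 : 1 ≤ p) (hp : ENNReal.ofReal (2 * (d : ℝ) / ((d : ℝ) + s)) < p)
    (c : Equiv.Perm (Fin ((d + d) + (d + d)))) (hc : MixedMod.IsSlicePermutation c)
    (φ ψ : 𝓢(EuclideanSpace ℝ (Fin (d + d)), ℂ)) (hφ : φ ≠ 0) (hψ : ψ ≠ 0) :
    MixedMod.modulationSpace φ 2 2 (MixedMod.polyWeight s) ⊂
      MixedMod.mixedModulationSpace ψ c
        (Fin.append (fun _ : Fin (d + d) => (2 : ℝ≥0∞)) (fun _ : Fin (d + d) => p))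
        (fun _ => 1) := by
  have hd0 : (0 : ℝ) < d := by exact_mod_cast hd
  -- With n = 2d, the inequality n < (p/2)(2s + n) is 2d < p(d + s).
  have hsub := MixedMod.modulationSpace_subset (n := d + d) hs hp1 (fun hpt => by
    have h := (ENNReal.ofReal_lt_iff_lt_toReal (by positivity) hpt).1 hp
    rw [div_lt_iff₀ (by positivity)] at h
    push_cast
    linarith) c hφ ψ
  obtain ⟨f, hf, hf'⟩ : ∃ f ∈ MixedMod.mixedModulationSpace ψ c
      (Fin.append (fun _ : Fin (d + d) => (2 : ℝ≥0∞)) (fun _ : Fin (d + d) => p)) (fun _ => 1),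
      f ∉ MixedMod.modulationSpace φ 2 2 (MixedMod.polyWeight s) := by
    rcases hs.eq_or_lt with rfl | hs
    -- Position index d lies in the second slice, which c sends to the L^p block; for s = 0 the
    -- condition on p becomes p > 2.
    · set j : Fin (d + d) := ⟨d, by omega⟩ with hj
      have h1 : 2 * d ≤ (c (Fin.castAdd (d + d) j)).val :=
        hc.2.mapsTo (Or.inl ⟨by simp [hj], by simp [hj]; omega⟩)
      have h2 := (c (Fin.castAdd (d + d) j)).isLt
      have hp2 : 2 < p := by
        rwa [add_zero, mul_div_assoc, div_self hd0.ne', mul_one, ENNReal.ofReal_ofNat] at hp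
      exact MixedMod.exists_mem_notMem_of_natAdd hp2 (j := j)
        (l := ⟨(c (Fin.castAdd (d + d) j)).val - (d + d), by omega⟩)
        (Fin.ext (by simp only [Fin.val_natAdd]; omega)) hφ ψ
    -- Position index 0 lies in the first slice, which c sends to the L² block.
    · set j : Fin (d + d) := ⟨0, by omega⟩ with hj
      have h1 : (c (Fin.castAdd (d + d) j)).val < 2 * d :=
        hc.1.mapsTo (Or.inl (by simp [hj]; omega))
      exact MixedMod.exists_mem_notMem_of_castAdd hs hp1 (j := j)
        (l := ⟨(c (Fin.castAdd (d + d) j)).val, by omega⟩) rfl hφ ψ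
  exact ⟨hsub, fun h => hf' (h hf)⟩
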